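/- All logarithms are to base 2. A finite graph is simple and undirected. A graph $G=(V,E)$ is 2-vertex-connected if it is connected and, for every $u\in V$, the graph $G\setminus\{u\}$ is (nonempty and) connected. It is bridgeless if it is connected and $G\setminus\{e\}$ is connected for every edge $e$. A $(d,c)$-cycle cover of a graph is a finite collection of simple cycles of the graph, each of length at most $d$, such that each edge lies on at least one and at most $c$ of the cycles. A $(d,c)$-private neighborhood trees collection of $G$ is a family of subgraphs $(T(u))_{u\in V}$ of $G$ such that each $T(u)$ is a tree that contains all neighbors of $u$ but does not contain $u$, each $T(u)$ has diameter at most $d$, and each edge of $G$ lies in at most $c$ of the trees. **Theorem.** (1) There is an absolute constant $K$ such that every finite 2-vertex-connected graph $G$ with $n$ vertices, maximum degree $\Delta$ and diameter $D$ has a $(d,c)$-private neighborhood trees collection with $$d = K\cdot D\,\Delta\log n,\qquad c = K\cdot D\,\log\Delta\,\log^3 n .$$ (2) There is an absolute constant $K$ such that the following holds for every finite 2-vertex-connected graph $G$ with $m$ edges, maximum degree $\Delta$ and diameter $D$, and all natural numbers $d,c$. If every bridgeless graph with at most $Km$ vertices and diameter at most $KD$ has a $(d,c)$-cycle cover, then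 $G$ has a $(K d\Delta,\; K c\,d\log\Delta)$-private neighborhood trees collection. -/

import Mathlib

namespace PrivateTrees

/-- A graph is 2-vertex-connected if it is connected and stays connected (in particular nonempty)
after the removal of any single vertex. -/
def IsTwoVertexConnected {V : Type*} (G : SimpleGraph V) : Prop :=
  G.Connected ∧ ∀ u : V, (G.induce {u}ᶜ).Connected

/-- A graph is bridgeless if it is connected and stays connected after the removal of any single
edge. -/
def IsBridgeless {V : Type*} (G : SimpleGraph V) : Prop :=
  G.Connected ∧ ∀ e ∈ G.edgeSet, (G.deleteEdges {e}).Connected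

/-- `G` has a `(d, c)`-cycle cover: a finite collection of (simple) cycles of `G`, each of length at
most `d`, such that each edge of `G` lies on at least one and at most `c` of them. -/
def HasCycleCover {V : Type*} (G : SimpleGraph V) (d c : ℕ) : Prop :=
  ∃ (k : ℕ) (v : Fin k → V) (p : ∀ i, G.Walk (v i) (v i)),
    (∀ i, (p i).IsCycle) ∧
    (∀ i, (p i).length ≤ d) ∧
    ∀ e ∈ G.edgeSet, (∃ i, e ∈ (p i).edges) ∧ {i | e ∈ (p i).edges}.ncard ≤ c

/-- The family of subgraphs `T u` of `G` is a `(d, c)`-private neighborhood trees collection: each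
`T u` is a tree that contains all neighbors of `u` but not `u` itself, has diameter at most `d`, and
each edge of `G` lies in at most `c` of the trees. -/
structure IsPrivateNeighborhoodTrees {V : Type*} (G : SimpleGraph V) (T : V → G.Subgraph)
    (d c : ℝ) : Prop where
  isTree : ∀ u, (T u).coe.IsTree
  neighbors_subset : ∀ u, G.neighborSet u ⊆ (T u).verts
  avoids : ∀ u, u ∉ (T u).verts
  dilation : ∀ u, ((T u).coe.diam : ℝ) ≤ d
  congestion : ∀ e ∈ G.edgeSet, ({u | e ∈ (T u).edgeSet}.ncard : ℝ) ≤ c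

end PrivateTrees

/-!
For each vertex `u` we look for few edges avoiding `u` that connect the neighbors of `u`. Suppose
that the edges found so far group the neighbors of each `u` into classes, and fix one central class
for each `u`. Replace each vertex by a star with one node per class, with the central class at the
center, and let the edge `uv` join the nodes of the classes of `v` at `u` and of `u` at `v`. As `G`
is 2-vertex-connected, this gadget graph is bridgeless. In a cycle cover of it, take a cycle through
the edge from a leaf of the star of `u` to the center and follow it away from the center: the piece
up to the next node of that star projects to a walk of `G` that avoids `u` and joins the class of
the leaf to another class. Adding the edges of these cycles at least halves the number of
non-central classes, so that `log Δ + 1` rounds suffice. A vertex with `k` non-central classes uses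
`k` cycles, hence the number of edges added at `u` is a geometric series.

For the first part, cycle covers are found in the cycle space over `ℤ/2`. By averaging,
logarithmically many elements of the cycle space cover all edges, and it remains to write each of
them as a sum of short cycles with small congestion. In a rooted spanning tree of small depth, the
vertices whose root path uses a given edge are consecutive in depth-first order. The set of edges is
partitioned into groups of logarithmic size such that each set of consecutive vertices contains an
odd number of edge ends of only logarithmically many groups: cut the depth-first order into bins of
boundedly many edge ends, and take small cycles of the multigraph of bins as groups until half of
the edges are used up; then repeat this with the remaining edges. The sum of the fundamental cycles
over a group is short, and few of these sums use a given tree edge.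
-/

namespace PrivateTrees

open Finset Finsupp

/-! ### Small cycles in multigraphs -/

section Chains

variable {ι V M : Type*}

/-- The sum of the values of `φ` at the two ends of an edge. -/
def endSum [AddCommMonoid M] (φ : V → M) : Sym2 V → M :=
  Sym2.lift ⟨fun x y => φ x + φ y, fun _ _ => add_comm _ _⟩

@[simp]
theorem endSum_mk [AddCommMonoid M] (φ : V → M) (x y : V) : endSum φ s(x, y) = φ x + φ y := rfl

/-- The boundary map, on chains with coefficients in `ℤ/2`, of the multigraph on `V` whose edges
are the elements `i` of `ι`, with ends `ends i`. The chains of boundary `0` are the edge sets in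
which every degree is even. -/
noncomputable def boundary (ends : ι → Sym2 V) : (ι →₀ ZMod 2) →ₗ[ZMod 2] V →₀ ZMod 2 :=
  linearCombination (ZMod 2) (endSum (single · 1) ∘ ends)

@[simp]
theorem boundary_single (ends : ι → Sym2 V) (i : ι) :
    boundary ends (single i 1) = endSum (single · 1) (ends i) := by
  simp [boundary]

theorem linearCombination_boundary [AddCommGroup M] [Module (ZMod 2) M] (ends : ι → Sym2 V)
    (φ : V → M) (c : ι →₀ ZMod 2) :
    linearCombination (ZMod 2) φ (boundary ends c) =
      linearCombination (ZMod 2) (endSum φ ∘ ends) c := by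
  suffices linearCombination (ZMod 2) φ ∘ₗ boundary ends =
      linearCombination (ZMod 2) (endSum φ ∘ ends) from LinearMap.congr_fun this c
  refine Finsupp.lhom_ext' fun i => LinearMap.ext_ring ?_
  have (e : Sym2 V) : linearCombination (ZMod 2) φ (endSum (single · 1) e) = endSum φ e := by
    induction e with | _ x y => simp
  simp [this]

/-- The chain with coefficients in `ℤ/2` that corresponds to a set of edges. -/
noncomputable def chain (S : Finset ι) : ι →₀ ZMod 2 :=
  ∑ i ∈ S, single i 1

theorem chain_apply [DecidableEq ι] (S : Finset ι) (i : ι) :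
    chain S i = if i ∈ S then 1 else 0 := by
  simp [chain, Finsupp.finsetSum_apply, single_apply]

@[simp]
theorem support_chain (S : Finset ι) : (chain S).support = S := by
  classical
  ext i
  simp [chain_apply]

@[simp]
theorem chain_support (c : ι →₀ ZMod 2) : chain c.support = c := by
  classical
  ext i
  have : ∀ a : ZMod 2, (if a ≠ 0 then 1 else 0) = a := by decide
  simpa [chain_apply] using this (c i)

theorem chain_sdiff [DecidableEq ι] {S T : Finset ι} (h : T ⊆ S) :
    chain (S \ T) = chain S + chain T := by
  rw [← ZModModule.sub_eq_add, eq_sub_iff_add_eq]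
  exact sum_sdiff h

theorem linearCombination_chain [AddCommGroup M] [Module (ZMod 2) M] (φ : ι → M) (S : Finset ι) :
    linearCombination (ZMod 2) φ (chain S) = ∑ i ∈ S, φ i := by
  simp [chain]

theorem sum_endSum_eq_zero [AddCommGroup M] [Module (ZMod 2) M] {ends : ι → Sym2 V}
    {S : Finset ι} (hS : boundary ends (chain S) = 0) (φ : V → M) :
    ∑ i ∈ S, endSum φ (ends i) = 0 := by
  have := linearCombination_boundary ends φ (chain S)
  rwa [hS, map_zero, linearCombination_chain, eq_comm] at this

/-- The parity of the number of edge ends of the edge set `S` that lie in `L`. -/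
noncomputable def endParity (ends : ι → Sym2 V) (L : Set V) (S : Finset ι) : ZMod 2 :=
  ∑ f ∈ S, endSum (L.indicator 1) (ends f)

theorem endParity_union (ends : ι → Sym2 V) {L L' : Set V} (h : Disjoint L L') (S : Finset ι) :
    endParity ends (L ∪ L') S = endParity ends L S + endParity ends L' S := by
  rw [endParity, endParity, endParity, ← sum_add_distrib]
  refine sum_congr rfl fun f _ => ?_
  induction ends f with | _ x y =>
  simp only [endSum_mk, Set.indicator_union_of_disjoint h]
  exact add_add_add_comm _ _ _ _

theorem card_support_add_le (c c' : ι →₀ ZMod 2) :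
    #(c + c').support ≤ #c.support + #c'.support := by
  classical
  exact (card_le_card support_add).trans (card_union_le _ _)

end Chains

section SmallCycles

variable {ι V : Type*} {ends : ι → Sym2 V} {U B : Finset V} {F : Finset ι}

open Classical in
/-- The vertices of `U` at distance at most `r` from `v` in the multigraph with edge set `F`. Paths
are replaced by chains with the right boundary, so that no walks in a multigraph are needed. -/
noncomputable def chainBall (ends : ι → Sym2 V) (U : Finset V) (F : Finset ι) (v : V) (r : ℕ) :
    Finset V :=
  {w ∈ U | ∃ q : ι →₀ ZMod 2, q.support ⊆ F ∧ #q.support ≤ r ∧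
    boundary ends q = single v 1 + single w 1}

theorem mem_chainBall {v w : V} {r : ℕ} : w ∈ chainBall ends U F v r ↔
    w ∈ U ∧ ∃ q : ι →₀ ZMod 2, q.support ⊆ F ∧ #q.support ≤ r ∧
      boundary ends q = single v 1 + single w 1 := by
  simp [chainBall]

theorem chainBall_subset (v : V) (r : ℕ) : chainBall ends U F v r ⊆ U :=
  fun _ hw => (mem_chainBall.1 hw).1

theorem chainBall_mono (v : V) : Monotone (chainBall ends U F v) := by
  intro r s hrs w hw
  obtain ⟨hU, q, hqF, hqr, hq⟩ := mem_chainBall.1 hw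
  exact mem_chainBall.2 ⟨hU, q, hqF, hqr.trans hrs, hq⟩

theorem self_mem_chainBall {v : V} (hv : v ∈ U) (r : ℕ) : v ∈ chainBall ends U F v r :=
  mem_chainBall.2 ⟨hv, 0, by simp, by simp, by rw [map_zero, ZModModule.add_self]⟩

theorem mem_chainBall_succ {v x y : V} {r : ℕ} {f : ι} (hx : x ∈ chainBall ends U F v r)
    (hy : y ∈ U) (hf : f ∈ F) (hxy : ends f = s(x, y)) : y ∈ chainBall ends U F v (r + 1) := by
  classical
  obtain ⟨-, q, hqF, hqr, hq⟩ := mem_chainBall.1 hx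
  refine mem_chainBall.2 ⟨hy, q + single f 1, ?_, ?_, ?_⟩
  · exact support_add.trans (union_subset hqF (support_single_subset.trans (by simpa using hf)))
  · refine (card_support_add_le _ _).trans (add_le_add hqr ?_)
    exact card_le_card support_single_subset
  · rw [map_add, hq, boundary_single, hxy, endSum_mk, ZModModule.add_add_add_cancel]

theorem exists_card_chainBall_succ_le {v : V} (hv : v ∈ U) : ∃ r ≤ Nat.log 2 #U,
    #(chainBall ends U F v (r + 1)) ≤ 2 * #(chainBall ends U F v r) := by
  by_contra! hgrow
  have hpow : ∀ r ≤ Nat.log 2 #U + 1, 2 ^ r ≤ #(chainBall ends U F v r) := by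
    intro r
    induction r with
    | zero => exact fun _ => card_pos.2 ⟨v, self_mem_chainBall hv 0⟩
    | succ r ih =>
      intro hr
      have := ih (by omega)
      have := hgrow r (by omega)
      rw [pow_succ]
      omega
  have hle := (hpow _ le_rfl).trans (card_le_card (chainBall_subset v _))
  exact (Nat.lt_pow_succ_log_self one_lt_two #U).not_ge hle

theorem card_le_card_of_endSum_eq_single (q : V → ι →₀ ZMod 2)
    (hB : ∀ f ∈ F, ∀ x ∈ ends f, x ∈ B) (hq : ∀ f ∈ F, endSum q (ends f) = single f 1) :
    #F ≤ #B := by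
  classical
  have hspan : ∀ f : F, (single (f : ι) 1 : ι →₀ ZMod 2) ∈
      Submodule.span (ZMod 2) (B.image q : Set (ι →₀ ZMod 2)) := by
    rintro ⟨f, hf⟩
    have hqB : ∀ x ∈ ends f, q x ∈ Submodule.span (ZMod 2) (B.image q : Set (ι →₀ ZMod 2)) :=
      fun x hx => Submodule.subset_span (mem_image_of_mem q (hB f hf x hx))
    rw [← hq f hf]
    generalize ends f = e at hqB
    induction e with | _ x y => exact add_mem (hqB x (by simp)) (hqB y (by simp))
  have hli : LinearIndependent (ZMod 2)
      fun f : F => (⟨_, hspan f⟩ : Submodule.span (ZMod 2) (B.image q : Set (ι →₀ ZMod 2))) :=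
    .of_comp (Submodule.subtype _)
      ((linearIndependent_single_one (ZMod 2) ι).comp _ Subtype.val_injective)
  calc #F = Fintype.card F := (Fintype.card_coe F).symm
    _ ≤ _ := hli.fintype_card_le_finrank
    _ ≤ #(B.image q) := finrank_span_finset_le_card _
    _ ≤ #B := card_image_le

theorem exists_small_cycle_of_chainBall {F' : Finset ι} {v : V} {r : ℕ} (hF' : F' ⊆ F)
    (hends : ∀ f ∈ F', ∀ x ∈ ends f, x ∈ chainBall ends U F v r)
    (hlt : #(chainBall ends U F v r) < #F') :
    ∃ z ≠ 0, z.support ⊆ F ∧ #z.support ≤ 2 * r + 1 ∧ boundary ends z = 0 := by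
  classical
  have hpath : ∀ x, ∃ q : ι →₀ ZMod 2, x ∈ chainBall ends U F v r →
      q.support ⊆ F ∧ #q.support ≤ r ∧ boundary ends q = single v 1 + single x 1 := by
    intro x
    by_cases hx : x ∈ chainBall ends U F v r
    · exact (mem_chainBall.1 hx).2.imp fun _ hq _ => hq
    · exact ⟨0, fun h => absurd h hx⟩
  choose q hq using hpath
  obtain ⟨f, hf, hne⟩ : ∃ f ∈ F', endSum q (ends f) ≠ single f 1 := by
    by_contra! h
    exact hlt.not_ge (card_le_card_of_endSum_eq_single q hends h)
  refine ⟨endSum q (ends f) + single f 1, ?_, ?_⟩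
  · rwa [← ZModModule.sub_eq_add, sub_ne_zero]
  obtain ⟨x, y, hxy⟩ : ∃ x y, ends f = s(x, y) := Sym2.exists.1 ⟨_, rfl⟩
  obtain ⟨hxF, hxr, hx⟩ := hq x (hends f hf x (by simp [hxy]))
  obtain ⟨hyF, hyr, hy⟩ := hq y (hends f hf y (by simp [hxy]))
  have hf1 : (single f (1 : ZMod 2)).support ⊆ {f} := support_single_subset
  rw [hxy, endSum_mk, map_add, map_add, boundary_single, hxy, endSum_mk, hx, hy,
    add_comm (single v 1), ZModModule.add_add_add_cancel, ZModModule.add_self]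
  refine ⟨?_, ?_, rfl⟩
  · exact support_add.trans (union_subset (support_add.trans (union_subset hxF hyF))
      (hf1.trans (singleton_subset_iff.2 (hF' hf))))
  · have := card_support_add_le (q x + q y) (single f 1)
    have := card_support_add_le (q x) (q y)
    have := card_le_card hf1
    rw [card_singleton] at this
    omega

theorem exists_small_cycle_of_two_mul_card_lt (hF : ∀ f ∈ F, ∀ x ∈ ends f, x ∈ U)
    (hcard : 2 * #U < #F) : ∃ z ≠ 0,
      z.support ⊆ F ∧ #z.support ≤ 2 * Nat.log 2 #U + 3 ∧ boundary ends z = 0 := by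
  classical
  induction U using Finset.strongInduction generalizing F with | _ U ih =>
  obtain ⟨f₀, hf₀⟩ : F.Nonempty := card_pos.1 (by omega)
  obtain ⟨v, hv⟩ : ∃ v, v ∈ ends f₀ := ⟨_, (ends f₀).out_fst_mem⟩
  have hvU := hF f₀ hf₀ v hv
  obtain ⟨r, hr, hball⟩ := exists_card_chainBall_succ_le (ends := ends) (F := F) hvU
  set B := chainBall ends U F v r
  -- The edges that meet `B`: if there are many, they contain a small cycle close to `v`, and
  -- otherwise `B` can be deleted.
  set F' := {f ∈ F | ∃ x ∈ ends f, x ∈ B}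
  have hF' : F' ⊆ F := filter_subset _ _
  by_cases hlt : #(chainBall ends U F v (r + 1)) < #F'
  · obtain ⟨z, hz, hzF, hzr, hz0⟩ := exists_small_cycle_of_chainBall hF' (fun f hf y hy => by
      obtain ⟨hfF, x, hx, hxB⟩ := mem_filter.1 hf
      obtain rfl | hxy := eq_or_ne x y
      · exact chainBall_mono v r.le_succ hxB
      · exact mem_chainBall_succ hxB (hF f hfF y hy) hfF ((Sym2.mem_and_mem_iff hxy).1 ⟨hx, hy⟩))
      hlt
    exact ⟨z, hz, hzF, by omega, hz0⟩
  · have hBU : B ⊆ U := chainBall_subset v r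
    have hvB : v ∈ B := self_mem_chainBall hvU r
    have := card_pos.2 ⟨v, hvB⟩
    have := card_le_card hBU
    obtain ⟨z, hz, hzF, hzr, hz0⟩ := ih (U \ B) (sdiff_ssubset hBU ⟨v, hvB⟩) (F := F \ F')
      (fun f hf x hx => by
        obtain ⟨hfF, hfF'⟩ := mem_sdiff.1 hf
        exact mem_sdiff.2 ⟨hF f hfF x hx, fun hxB => hfF' (mem_filter.2 ⟨hfF, x, hx, hxB⟩)⟩)
      (by rw [card_sdiff_of_subset hBU, card_sdiff_of_subset hF']; omega)
    have := Nat.log_mono_right (b := 2) (card_le_card (sdiff_subset (s := U) (t := B)))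
    exact ⟨z, hz, hzF.trans sdiff_subset, by omega, hz0⟩

theorem exists_finpartition_parts_eq_union [DecidableEq ι] {s t : Finset ι} (P : Finpartition s)
    (Q : Finpartition t) (hst : Disjoint s t) :
    ∃ R : Finpartition (s ∪ t), R.parts = P.parts ∪ Q.parts := by
  refine ⟨⟨P.parts ∪ Q.parts, supIndep_iff_pairwiseDisjoint.2 ?_, ?_, by simp⟩, rfl⟩
  · rw [coe_union]
    exact P.disjoint.union Q.disjoint fun a ha b hb _ => hst.mono (P.le ha) (Q.le hb)
  · rw [sup_union, P.sup_parts, Q.sup_parts, sup_eq_union]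

theorem exists_finpartition_small_cycles [DecidableEq ι] (hF : ∀ f ∈ F, ∀ x ∈ ends f, x ∈ U) :
    ∃ F' ⊆ F, #(F \ F') ≤ 2 * #U ∧ ∃ P : Finpartition F', ∀ S ∈ P.parts,
      #S ≤ 2 * Nat.log 2 #U + 3 ∧ boundary ends (chain S) = 0 := by
  induction F using Finset.strongInduction with | _ F ih =>
  obtain hle | hlt := le_or_gt #F (2 * #U)
  · exact ⟨∅, empty_subset F, by simpa using hle, Finpartition.empty _, by simp⟩
  obtain ⟨z, hz, hzF, hzU, hz0⟩ := exists_small_cycle_of_two_mul_card_lt hF hlt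
  have hzne : z.support.Nonempty := support_nonempty_iff.2 hz
  obtain ⟨F', hF', hcard, P, hP⟩ := ih (F \ z.support) (sdiff_ssubset hzF hzne)
    fun f hf => hF f (sdiff_subset hf)
  refine ⟨F' ∪ z.support, union_subset (hF'.trans sdiff_subset) hzF, ?_,
    P.extend hzne.ne_empty (disjoint_of_subset_left hF' sdiff_disjoint) rfl, ?_⟩
  · rwa [union_comm, ← sup_eq_union, ← sdiff_sdiff_left]
  · simpa [hzU, hz0] using hP

end SmallCycles

section Grouping

variable {δ ι α : Type*} [LinearOrder α]

theorem exists_injOn_rank (D : Finset δ) (pos : δ → α) :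
    ∃ ρ : δ → ℕ, Set.InjOn ρ D ∧ (∀ d ∈ D, ρ d < #D) ∧
      ∀ d ∈ D, ∀ d' ∈ D, ρ d ≤ ρ d' → pos d ≤ pos d' := by
  classical
  induction D using induction_on_max_value pos with
  | empty => exact ⟨0, by simp⟩
  | insert a s has hmax ih =>
    obtain ⟨ρ, hinj, hlt, hmono⟩ := ih
    have hρ : ∀ d ∈ s, Function.update ρ a #s d = ρ d := fun d hd =>
      Function.update_of_ne (ne_of_mem_of_not_mem hd has) _ _
    refine ⟨Function.update ρ a #s, ?_, ?_, ?_⟩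
    · rw [coe_insert, Set.injOn_insert (mod_cast has)]
      refine ⟨hinj.congr fun d hd => (hρ d hd).symm, ?_⟩
      rintro ⟨d, hd, hda⟩
      rw [hρ d hd, Function.update_self] at hda
      exact (hlt d hd).ne hda
    · rw [card_insert_of_notMem has, forall_mem_insert, Function.update_self]
      exact ⟨Nat.lt_succ_self _, fun d hd => hρ d hd ▸ (hlt d hd).trans (Nat.lt_succ_self _)⟩
    · simp only [forall_mem_insert, Function.update_self, le_refl, forall_const, true_and]
      refine ⟨fun d hd h => ?_, fun d hd => ⟨fun _ => hmax d hd, fun d' hd' h => ?_⟩⟩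
      · exact absurd (hρ d hd ▸ h) (hlt d hd).not_ge
      · exact hmono d hd d' hd' (by rwa [hρ d hd, hρ d' hd'] at h)

theorem exists_bins (D : Finset δ) (pos : δ → α) {k : ℕ} (hk : 0 < k) :
    ∃ bin : δ → ℕ, (∀ d ∈ D, bin d ≤ #D / k) ∧ (∀ t, #{d ∈ D | bin d = t} ≤ k) ∧
      ∀ L : Set α, IsLowerSet L → ∃ t, ∀ d ∈ D, bin d ≠ t → (pos d ∈ L ↔ bin d < t) := by
  obtain ⟨ρ, hinj, hlt, hmono⟩ := exists_injOn_rank D pos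
  refine ⟨fun d => ρ d / k, fun d hd => Nat.div_le_div_right (hlt d hd).le, fun t => ?_,
    fun L hL => ?_⟩
  · refine (card_le_card_of_injOn (t := Ico (k * t) (k * t + k)) ρ ?_ ?_).trans_eq (by simp)
    · rintro d hd
      rw [← (mem_filter.1 hd).2, coe_Ico, ← Nat.mul_succ]
      exact ⟨Nat.mul_div_le _ _, Nat.lt_mul_div_succ _ hk⟩
    · exact hinj.mono fun d hd => (mem_filter.1 hd).1
  · classical
    have hL' : ∀ d ∈ D, pos d ∈ L ↔ ρ d < {d ∈ D | pos d ∈ L}.sup fun d => ρ d + 1 := by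
      intro d hd
      simp only [Finset.lt_sup_iff, mem_filter, Nat.lt_succ_iff]
      exact ⟨fun h => ⟨d, ⟨hd, h⟩, le_rfl⟩,
        fun ⟨d', ⟨hd', hdL⟩, h⟩ => hL (hmono d hd d' hd' h) hdL⟩
    refine ⟨({d ∈ D | pos d ∈ L}.sup fun d => ρ d + 1) / k, fun d hd hne => ?_⟩
    rw [hL' d hd]
    exact ⟨fun h => (Nat.div_le_div_right h.le).lt_of_ne hne, Nat.lt_of_div_lt_div⟩

theorem exists_half_grouping [DecidableEq ι] (ends : ι → Sym2 α) {F : Finset ι} (hF : 8 ≤ #F) :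
    ∃ F' ⊆ F, #(F \ F') ≤ #F / 2 ∧ ∃ P : Finpartition F',
      (∀ S ∈ P.parts, #S ≤ 2 * Nat.log 2 #F + 3) ∧
      ∀ L : Set α, IsLowerSet L → #{S ∈ P.parts | endParity ends L S ≠ 0} ≤ 16 := by
  classical
  obtain ⟨pos, hpos⟩ : ∃ pos : ι × Bool → α, ∀ f, ends f = s(pos (f, false), pos (f, true)) :=
    ⟨fun d => bif d.2 then (ends d.1).out.2 else (ends d.1).out.1, fun f => (ends f).out_eq.symm⟩
  -- Edges become edges between bins of 16 consecutive ends. A group that is a cycle of bins has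
  -- an even number of ends in a lower set `L`, unless it has an end in the one bin that `L` splits.
  obtain ⟨bin, hbin, hbin16, hbinL⟩ := exists_bins (F ×ˢ univ) pos (k := 16) (by norm_num)
  have hcardF : #(F ×ˢ (univ : Finset Bool)) / 16 = #F / 8 := by
    rw [card_product, card_univ, Fintype.card_bool]
    omega
  obtain ⟨F', hF', hcard, P, hP⟩ := exists_finpartition_small_cycles (F := F)
    (ends := fun f => s(bin (f, false), bin (f, true))) (U := range (#F / 8 + 1))
    fun f hf x hx => by
      rw [mem_range, Nat.lt_succ_iff, ← hcardF]
      obtain rfl | rfl := Sym2.mem_iff.1 hx <;> exact hbin _ (by simpa using hf)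
  rw [card_range] at hcard hP
  refine ⟨F', hF', by omega, P, fun S hS => (hP S hS).1.trans ?_, fun L hL => ?_⟩
  · gcongr
    omega
  obtain ⟨t, ht⟩ := hbinL L hL
  have hodd : ∀ S ∈ P.parts, endParity ends L S ≠ 0 → ∃ d : ι × Bool, bin d = t ∧ d.1 ∈ S := by
    intro S hS hne
    by_contra! hbt
    refine hne ((sum_congr rfl fun f hf => ?_).trans
      (sum_endSum_eq_zero (hP S hS).2 ((Set.Iio t).indicator 1)))
    have hiff : ∀ b, pos (f, b) ∈ L ↔ bin (f, b) ∈ Set.Iio t := fun b =>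
      ht (f, b) (by simpa using hF' (P.le hS hf)) fun h => hbt (f, b) h hf
    simp only [hpos, endSum_mk, Set.indicator_apply, hiff, Pi.one_apply]
  refine le_trans ?_ (hbin16 t)
  refine card_le_card_of_forall_subsingleton (fun S d => d.1 ∈ S) (fun S hS => ?_)
    fun d _ S hS T hT => ?_
  · obtain ⟨hSP, hne⟩ := mem_filter.1 hS
    obtain ⟨d, hdt, hdS⟩ := hodd S hSP hne
    exact ⟨d, mem_filter.2 ⟨by simpa using hF' (P.le hSP hdS), hdt⟩, hdS⟩
  · exact P.eq_of_mem_parts (mem_filter.1 hS.1).1 (mem_filter.1 hT.1).1 hS.2 hT.2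

theorem exists_grouping [DecidableEq ι] (ends : ι → Sym2 α) (F : Finset ι) :
    ∃ P : Finpartition F, (∀ S ∈ P.parts, #S ≤ 2 * Nat.log 2 #F + 3) ∧
      ∀ L : Set α, IsLowerSet L →
        #{S ∈ P.parts | endParity ends L S ≠ 0} ≤ 16 * Nat.log 2 #F + 8 := by
  induction F using Finset.strongInduction with | _ F ih =>
  obtain hlt | hF := lt_or_ge #F 8
  · refine ⟨⊥, fun S hS => ?_, fun L _ => (card_filter_le _ _).trans ?_⟩
    · obtain ⟨f, -, rfl⟩ := Finpartition.mem_bot_iff.1 hS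
      simp
    · rw [Finpartition.card_bot]
      omega
  obtain ⟨F', hF', hhalf, P, hPS, hPL⟩ := exists_half_grouping ends hF
  have hF'ne : F'.Nonempty := by
    rw [nonempty_iff_ne_empty]
    rintro rfl
    rw [sdiff_empty] at hhalf
    omega
  obtain ⟨Q, hQS, hQL⟩ := ih (F \ F') (sdiff_ssubset hF' hF'ne)
  obtain ⟨R, hR⟩ := exists_finpartition_parts_eq_union P Q disjoint_sdiff
  have hlog : Nat.log 2 #(F \ F') + 1 ≤ Nat.log 2 #F := by
    rw [Nat.log_of_one_lt_of_le one_lt_two (by omega : 2 ≤ #F)]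
    exact Nat.add_le_add_right (Nat.log_mono_right hhalf) 1
  refine ⟨R.copy (union_sdiff_of_subset hF'), fun S hS => ?_, fun L hL => ?_⟩
  · obtain hS | hS := mem_union.1 (hR ▸ hS)
    · exact hPS S hS
    · exact (hQS S hS).trans (by omega)
  · rw [Finpartition.copy_parts, hR, filter_union]
    exact (card_union_le _ _).trans ((add_le_add (hPL L hL) (hQL L hL)).trans (by omega))

theorem exists_grouping_ordConnected [DecidableEq ι] (ends : ι → Sym2 α) (F : Finset ι) :
    ∃ P : Finpartition F, (∀ S ∈ P.parts, #S ≤ 2 * Nat.log 2 #F + 3) ∧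
      ∀ I : Set α, I.OrdConnected →
        #{S ∈ P.parts | endParity ends I S ≠ 0} ≤ 32 * Nat.log 2 #F + 16 := by
  obtain ⟨P, hPS, hPL⟩ := exists_grouping ends F
  refine ⟨P, hPS, fun I hI => ?_⟩
  -- `I` is the difference of two lower sets.
  set L : Set α := ↑(lowerClosure I)
  have hIL : I ⊆ L := subset_lowerClosure
  have hL : IsLowerSet L := (lowerClosure I).lower
  have hLI : IsLowerSet (L \ I) := by
    rintro x y hyx ⟨hx, hxI⟩
    refine ⟨hL hyx hx, fun hyI => hxI ?_⟩
    obtain ⟨z, hz, hxz⟩ := hx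
    exact hI.out hyI hz ⟨hyx, hxz⟩
  have hsub : {S ∈ P.parts | endParity ends I S ≠ 0} ⊆
      {S ∈ P.parts | endParity ends L S ≠ 0} ∪ {S ∈ P.parts | endParity ends (L \ I) S ≠ 0} := by
    rw [← filter_or]
    refine monotone_filter_right _ fun S _ hne => ?_
    by_contra! h
    have := endParity_union ends (Set.disjoint_sdiff_right (s := I) (t := L)) S
    rw [Set.union_sdiff_cancel hIL, h.1, h.2, add_zero] at this
    exact hne this.symm
  calc #{S ∈ P.parts | endParity ends I S ≠ 0} ≤ _ := card_le_card hsub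
    _ ≤ _ := card_union_le _ _
    _ ≤ _ := add_le_add (hPL L hL) (hPL _ hLI)
    _ = 32 * Nat.log 2 #F + 16 := by ring

end Grouping

/-! ### Cycle covers of bridgeless graphs -/

section CycleSpace

variable {V : Type*} {G : SimpleGraph V}

/-- The cycle space of `G`: the chains of edges of `G` without boundary. -/
noncomputable def cycleSpace (G : SimpleGraph V) : Submodule (ZMod 2) (Sym2 V →₀ ZMod 2) :=
  Finsupp.supported (ZMod 2) (ZMod 2) G.edgeSet ⊓ LinearMap.ker (boundary id)

theorem mem_cycleSpace {z : Sym2 V →₀ ZMod 2} :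
    z ∈ cycleSpace G ↔ (z.support : Set (Sym2 V)) ⊆ G.edgeSet ∧ boundary id z = 0 := by
  rw [cycleSpace, Submodule.mem_inf, mem_supported, LinearMap.mem_ker]

/-- `S` is the edge set of a simple cycle of `G`. -/
def IsCycleEdges (G : SimpleGraph V) (S : Finset (Sym2 V)) : Prop :=
  ∃ (v : V) (p : G.Walk v v), p.IsCycle ∧ ∀ e, e ∈ S ↔ e ∈ p.edges

theorem IsCycleEdges.nonempty {S : Finset (Sym2 V)} (h : IsCycleEdges G S) : S.Nonempty := by
  obtain ⟨v, p, hp, hS⟩ := h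
  cases p with
  | nil => exact absurd rfl hp.ne_nil
  | cons h p => exact ⟨_, (hS _).2 List.mem_cons_self⟩

theorem boundary_sum_edges {u v : V} (p : G.Walk u v) :
    boundary id (p.edges.map fun e => single e 1).sum = single u 1 + single v 1 := by
  induction p with
  | nil =>
    rw [SimpleGraph.Walk.edges_nil, List.map_nil, List.sum_nil, map_zero, ZModModule.add_self]
  | cons h p ih =>
    rw [SimpleGraph.Walk.edges_cons, List.map_cons, List.sum_cons, map_add, ih, boundary_single,
      id, endSum_mk, ZModModule.add_add_add_cancel]

theorem IsCycleEdges.chain_mem_cycleSpace {S : Finset (Sym2 V)} (h : IsCycleEdges G S) :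
    chain S ∈ cycleSpace G := by
  classical
  obtain ⟨v, p, hp, hS⟩ := h
  refine mem_cycleSpace.2 ⟨fun e he => ?_, ?_⟩
  · rw [support_chain] at he
    exact p.edges_subset_edgeSet ((hS e).1 he)
  · obtain rfl : S = p.edges.toFinset := by
      ext e
      rw [hS, List.mem_toFinset]
    rw [chain, List.sum_toFinset _ hp.isCircuit.isTrail.edges_nodup, boundary_sum_edges,
      ZModModule.add_self]

theorem reachable_deleteEdges_of_boundary_eq_zero {C : Finset (Sym2 V)}
    (hC : boundary id (chain C) = 0) {x y : V} (hxy : s(x, y) ∈ C) :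
    ((SimpleGraph.fromEdgeSet (C : Set (Sym2 V))).deleteEdges {s(x, y)}).Reachable x y := by
  classical
  set H := (SimpleGraph.fromEdgeSet (C : Set (Sym2 V))).deleteEdges {s(x, y)}
  by_contra hnot
  -- Otherwise `s(x, y)` is the only edge of `C` that leaves the component `X` of `x`.
  set X : Set V := {z | H.Reachable x z}
  have hX : ∀ f ∈ C.erase s(x, y), endSum (X.indicator (1 : V → ZMod 2)) f = 0 := by
    intro f hf
    obtain ⟨hne, hfC⟩ := mem_erase.1 hf
    induction f with | _ u v =>
    have huv : H.Reachable u v := by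
      obtain rfl | huv := eq_or_ne u v
      · rfl
      · exact SimpleGraph.Adj.reachable (by simp [H, hfC, huv, hne])
    have hiff : u ∈ X ↔ v ∈ X := ⟨fun h => h.trans huv, fun h => h.trans huv.symm⟩
    rw [endSum_mk, Set.indicator_apply, Set.indicator_apply]
    simp only [hiff]
    exact ZModModule.add_self _
  have hsum := sum_endSum_eq_zero hC (X.indicator (1 : V → ZMod 2))
  simp only [id] at hsum
  rw [← add_sum_erase C _ hxy, sum_eq_zero hX, endSum_mk,
    Set.indicator_of_mem (show x ∈ X from .refl x), Set.indicator_of_notMem (show y ∉ X from hnot)]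
    at hsum
  simp at hsum

theorem exists_isCycleEdges_subset {C : Finset (Sym2 V)} (hC : chain C ∈ cycleSpace G)
    {e : Sym2 V} (he : e ∈ C) : ∃ S ⊆ C, e ∈ S ∧ IsCycleEdges G S := by
  classical
  obtain ⟨hCG, hC0⟩ := mem_cycleSpace.1 hC
  rw [support_chain] at hCG
  induction e with | _ x y =>
  set H := SimpleGraph.fromEdgeSet (C : Set (Sym2 V))
  have hHG : H ≤ G := fun u v h => hCG ((SimpleGraph.fromEdgeSet_adj _).1 h).1
  have hadj : H.Adj x y := (SimpleGraph.fromEdgeSet_adj _).2 ⟨he, (hCG he : G.Adj x y).ne⟩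
  obtain ⟨u, p, hp, hmem⟩ := SimpleGraph.adj_and_reachable_delete_edges_iff_exists_cycle.1
    ⟨hadj, reachable_deleteEdges_of_boundary_eq_zero hC0 he⟩
  refine ⟨p.edges.toFinset, fun f hf => ?_, List.mem_toFinset.2 hmem, u, p.mapLe hHG,
    hp.mapLe hHG, fun f => ?_⟩
  · have hfH := p.edges_subset_edgeSet (List.mem_toFinset.1 hf)
    rw [SimpleGraph.edgeSet_fromEdgeSet] at hfH
    exact hfH.1
  · rw [SimpleGraph.Walk.edges_mapLe_eq_edges, List.mem_toFinset]

theorem exists_finpartition_isCycleEdges [DecidableEq V] {C : Finset (Sym2 V)}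
    (hC : chain C ∈ cycleSpace G) :
    ∃ P : Finpartition C, ∀ S ∈ P.parts, IsCycleEdges G S := by
  induction C using Finset.strongInduction with | _ C ih =>
  obtain rfl | ⟨e, he⟩ := C.eq_empty_or_nonempty
  · exact ⟨Finpartition.empty _, by simp⟩
  obtain ⟨S, hSC, -, hS⟩ := exists_isCycleEdges_subset hC he
  obtain ⟨P, hP⟩ := ih (C \ S) (sdiff_ssubset hSC hS.nonempty)
    (chain_sdiff hSC ▸ add_mem hC hS.chain_mem_cycleSpace)
  exact ⟨P.extend hS.nonempty.ne_empty sdiff_disjoint (sdiff_union_of_subset hSC),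
    by simpa [hS] using hP⟩

theorem IsBridgeless.exists_mem_cycleSpace (hG : IsBridgeless G) {e : Sym2 V}
    (he : e ∈ G.edgeSet) : ∃ z ∈ cycleSpace G, z e ≠ 0 := by
  classical
  have hreach := (hG.2 e he).preconnected
  induction e with | _ x y =>
  obtain ⟨u, p, hp, hmem⟩ :=
    SimpleGraph.adj_and_reachable_delete_edges_iff_exists_cycle.1 ⟨he, hreach x y⟩
  exact ⟨chain p.edges.toFinset, IsCycleEdges.chain_mem_cycleSpace ⟨u, p, hp, by simp⟩,
    by simp [chain_apply, hmem]⟩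

end CycleSpace

section Averaging

variable {ι : Type*} {W : Submodule (ZMod 2) (ι →₀ ZMod 2)} [Finite W] {A : Finset ι}

-- Averaging: a coordinate that does not vanish on `W` is nonzero at half of the elements of `W`.
theorem exists_mem_card_filter_eq_zero_le (hA : ∀ e ∈ A, ∃ z ∈ W, z e ≠ 0) :
    ∃ z ∈ W, #{e ∈ A | z e = 0} ≤ #A / 2 := by
  classical
  have := Fintype.ofFinite W
  have hcoord : ∀ e ∈ A, #{z : W | z.1 e = 0} ≤ #{z : W | ¬z.1 e = 0} := by
    intro e he
    obtain ⟨z₀, hz₀, hne⟩ := hA e he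
    refine card_le_card_of_injOn (· + ⟨z₀, hz₀⟩) (fun z hz => ?_) (add_left_injective _).injOn
    simpa [(mem_filter.1 hz).2] using hne
  have hsum : ∑ z : W, #{e ∈ A | z.1 e = 0} ≤ ∑ z : W, #{e ∈ A | ¬z.1 e = 0} := by
    simp only [card_filter]
    rw [Finset.sum_comm, Finset.sum_comm (s := univ)]
    simpa only [card_filter] using sum_le_sum hcoord
  obtain ⟨z, -, hz⟩ := exists_le_of_sum_le univ_nonempty hsum
  refine ⟨z, z.2, ?_⟩
  have := card_filter_add_card_filter_not (s := A) (fun e => z.1 e = 0)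
  omega

theorem exists_cover_of_card_lt_two_pow (hA : ∀ e ∈ A, ∃ z ∈ W, z e ≠ 0) {k : ℕ}
    (hk : #A < 2 ^ k) :
    ∃ Q : Finset (ι →₀ ZMod 2), #Q ≤ k ∧ (∀ z ∈ Q, z ∈ W) ∧ ∀ e ∈ A, ∃ z ∈ Q, z e ≠ 0 := by
  classical
  induction k generalizing A with
  | zero =>
    obtain rfl : A = ∅ := by simpa using hk
    exact ⟨∅, by simp⟩
  | succ k ih =>
    obtain ⟨z, hzW, hz⟩ := exists_mem_card_filter_eq_zero_le hA
    obtain ⟨Q, hQk, hQW, hQA⟩ := ih (A := {e ∈ A | z e = 0})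
      (fun e he => hA e (mem_filter.1 he).1) (by rw [pow_succ] at hk; omega)
    refine ⟨insert z Q, (card_insert_le z Q).trans (by omega), by simpa [hzW] using hQW,
      fun e he => ?_⟩
    by_cases hze : z e = 0
    · obtain ⟨y, hy, hye⟩ := hQA e (mem_filter.2 ⟨he, hze⟩)
      exact ⟨y, mem_insert_of_mem hy, hye⟩
    · exact ⟨z, mem_insert_self z Q, hze⟩

end Averaging

section RootPaths

theorem ordConnected_setOf_isPrefix {α : Type*} [LinearOrder α] (p : List α) :
    {l : List α | p <+: l}.OrdConnected := by
  refine ⟨?_⟩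
  rintro l₁ h₁ l₃ h₃ l₂ ⟨h₁₂, h₂₃⟩
  induction p generalizing l₁ l₂ l₃ with
  | nil => exact List.nil_prefix
  | cons x p ih =>
    obtain ⟨t₁, rfl⟩ := h₁
    obtain ⟨t₃, rfl⟩ := h₃
    cases l₂ with
    | nil => exact absurd (List.nil_lt_cons _ _) h₁₂.not_gt
    | cons y l₂ =>
      rw [List.cons_append, ← not_lt, List.cons_lt_cons_iff, not_or, not_and] at h₁₂ h₂₃
      obtain rfl : x = y := le_antisymm (not_lt.1 h₁₂.1) (not_lt.1 h₂₃.1)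
      exact List.cons_prefix_cons.2 ⟨rfl, ih ⟨t₁, rfl⟩ ⟨t₃, rfl⟩ (not_lt.1 (h₁₂.2 rfl))
        (not_lt.1 (h₂₃.2 rfl))⟩

variable {V : Type*}

/-- The last `k` vertices of the path to `v` in the tree with parent function `par`. -/
def ancestorList (par : V → V) : ℕ → V → List V
  | 0, _ => []
  | k + 1, v => ancestorList par k (par v) ++ [v]

/-- The last `k` edges, as a chain, of the path to `v` in the tree with parent function `par`. -/
noncomputable def ancestorPath (par : V → V) : ℕ → V → Sym2 V →₀ ZMod 2
  | 0, _ => 0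
  | k + 1, v => ancestorPath par k (par v) + single s(par v, v) 1

variable {par : V → V}

theorem length_ancestorList (k : ℕ) (v : V) : (ancestorList par k v).length = k := by
  induction k generalizing v with
  | zero => rfl
  | succ k ih => rw [ancestorList, List.length_append, ih, List.length_singleton]

theorem card_support_ancestorPath_le (k : ℕ) (v : V) : #(ancestorPath par k v).support ≤ k := by
  induction k generalizing v with
  | zero => rfl
  | succ k ih =>
    exact (card_support_add_le _ _).trans (add_le_add (ih _) (card_le_card support_single_subset))

variable {h : V → ℕ}

theorem boundary_ancestorPath (hpar : ∀ v, h v ≠ 0 → h (par v) + 1 = h v) {r : V}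
    (hr : ∀ v, h v = 0 → v = r) (v : V) :
    boundary id (ancestorPath par (h v) v) = single r 1 + single v 1 := by
  induction hk : h v generalizing v with
  | zero => rw [hr v hk, ancestorPath, map_zero, ZModModule.add_self]
  | succ k ih =>
    have := hpar v (by omega)
    rw [ancestorPath, map_add, ih _ (by omega), boundary_single, id, endSum_mk,
      ZModModule.add_add_add_cancel]

theorem exists_of_ancestorPath_apply_ne_zero (hpar : ∀ v, h v ≠ 0 → h (par v) + 1 = h v) {v : V}
    {e : Sym2 V} (he : ancestorPath par (h v) v e ≠ 0) : ∃ x, h x ≠ 0 ∧ s(par x, x) = e := by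
  classical
  induction hk : h v generalizing v with
  | zero => simp [hk, ancestorPath] at he
  | succ k ih =>
    have hv := hpar v (by omega)
    by_cases hve : s(par v, v) = e
    · exact ⟨v, by omega, hve⟩
    · rw [hk, ancestorPath, Finsupp.add_apply, single_eq_of_ne' hve, add_zero] at he
      have hk' : h (par v) = k := by omega
      exact ih (hk'.symm ▸ he) hk'

theorem parent_edge_injOn (hpar : ∀ v, h v ≠ 0 → h (par v) + 1 = h v) :
    Set.InjOn (fun x => s(par x, x)) {x | h x ≠ 0} := by
  rintro x hx y hy hxy
  obtain ⟨-, h₂⟩ | ⟨h₁, h₂⟩ := Sym2.eq_iff.1 hxy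
  · exact h₂
  · have := hpar x hx
    have := hpar y hy
    rw [h₁] at *
    rw [← h₂] at *
    omega

theorem ancestorPath_apply (hpar : ∀ v, h v ≠ 0 → h (par v) + 1 = h v) {x : V} (hx : h x ≠ 0)
    (v : V) : ancestorPath par (h v) v s(par x, x) =
      {l | ancestorList par (h x) x <+: l}.indicator 1 (ancestorList par (h v) v) := by
  classical
  have hlen {y : V} (hy : ancestorList par (h x) x <+: ancestorList par (h y) y) : h x ≤ h y := by
    simpa only [length_ancestorList] using hy.length_le
  induction hk : h v generalizing v with
  | zero =>
    rw [Set.indicator_of_notMem fun hmem => hx (by have := hlen (hk.symm ▸ hmem); omega)]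
    rfl
  | succ k ih =>
    have hv := hpar v (by omega)
    obtain rfl : h (par v) = k := by omega
    rw [ancestorPath, Finsupp.add_apply, ih (par v) rfl, ancestorList]
    simp only [Set.indicator_apply, Set.mem_ofPred_eq, List.prefix_concat_iff, Pi.one_apply]
    obtain rfl | hxv := eq_or_ne x v
    · have hnot : ¬ancestorList par (h x) x <+: ancestorList par (h (par x)) (par x) :=
        fun hle => by have := hlen hle; omega
      have hself : ancestorList par (h x) x = ancestorList par (h (par x)) (par x) ++ [x] := by
        rw [← hv, ancestorList]
      rw [if_neg hnot, if_pos (.inl hself), single_eq_same, zero_add]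
    · have hedge : s(par v, v) ≠ s(par x, x) := fun heq =>
        hxv (parent_edge_injOn hpar hx (by simp [hk]) heq.symm)
      have hlist : ancestorList par (h x) x ≠ ancestorList par (h (par v)) (par v) ++ [v] := by
        obtain ⟨j, hj⟩ := Nat.exists_eq_succ_of_ne_zero hx
        rw [hj, ancestorList]
        exact fun heq => hxv (List.append_singleton_inj.1 heq).2
      rw [single_eq_of_ne' hedge, add_zero]
      simp only [hlist, false_or]

/-- A system of paths of length at most `G.diam`, as chains, from the vertices of `G` to a root,
together with labels of the vertices in a linear order such that, for each edge, the vertices whose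
path uses that edge are consecutive. -/
structure RootPaths (G : SimpleGraph V) (α : Type*) [Preorder α] where
  root : V
  path : V → Sym2 V →₀ ZMod 2
  label : V → α
  support_subset : ∀ v, ((path v).support : Set (Sym2 V)) ⊆ G.edgeSet
  card_support_le : ∀ v, #(path v).support ≤ G.diam
  boundary_path : ∀ v, boundary id (path v) = single root 1 + single v 1
  exists_ordConnected : ∀ e, ∃ I : Set α, I.OrdConnected ∧ ∀ v, path v e = I.indicator 1 (label v)

variable {G : SimpleGraph V}

theorem exists_parent (hG : G.Connected) (r v : V) :
    ∃ w, G.dist v r ≠ 0 → G.Adj w v ∧ G.dist w r + 1 = G.dist v r := by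
  obtain ⟨p, hp⟩ := hG.exists_walk_length_eq_dist v r
  cases p with
  | nil => exact ⟨r, fun h => absurd SimpleGraph.dist_self h⟩
  | @cons _ w _ hadj q =>
    refine ⟨w, fun _ => ⟨hadj.symm, ?_⟩⟩
    have hwr := SimpleGraph.dist_le q
    have hvr : G.dist v r ≤ G.dist v w + G.dist w r := hG.dist_triangle
    rw [SimpleGraph.dist_eq_one_iff_adj.2 hadj] at hvr
    rw [SimpleGraph.Walk.length_cons] at hp
    omega

theorem nonempty_rootPaths [Finite V] [LinearOrder V] (hG : G.Connected) :
    Nonempty (RootPaths G (List V)) := by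
  obtain ⟨r⟩ := hG.nonempty
  have : Nonempty V := ⟨r⟩
  choose par hpar using exists_parent hG r
  have hdist : ∀ v, G.dist v r ≠ 0 → G.dist (par v) r + 1 = G.dist v r := fun v hv => (hpar v hv).2
  refine ⟨{
    root := r
    path := fun v => ancestorPath par (G.dist v r) v
    label := fun v => ancestorList par (G.dist v r) v
    support_subset := fun v e he => by
      obtain ⟨x, hx, rfl⟩ := exists_of_ancestorPath_apply_ne_zero hdist (mem_support_iff.1 he)
      exact (hpar x hx).1
    card_support_le := fun v => (card_support_ancestorPath_le _ _).trans
      (SimpleGraph.dist_le_diam (SimpleGraph.connected_iff_ediam_ne_top.1 hG))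
    boundary_path := boundary_ancestorPath hdist fun _ => hG.dist_eq_zero_iff.1
    exists_ordConnected := fun e => ?_ }⟩
  by_cases he : ∃ x, G.dist x r ≠ 0 ∧ s(par x, x) = e
  · obtain ⟨x, hx, rfl⟩ := he
    exact ⟨_, ordConnected_setOf_isPrefix _, ancestorPath_apply hdist hx⟩
  · refine ⟨∅, Set.ordConnected_empty, fun v => ?_⟩
    rw [Set.indicator_empty]
    exact not_not.1 fun hne => he (exists_of_ancestorPath_apply_ne_zero hdist hne)

end RootPaths

section CycleCover

variable {V α : Type*} {G : SimpleGraph V}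

namespace RootPaths

section Preorder

variable [Preorder α] (R : RootPaths G α)

/-- The fundamental cycle of an edge `f`: the edge together with the paths from the root to its two
ends. -/
noncomputable def fundamental (f : Sym2 V) : Sym2 V →₀ ZMod 2 :=
  single f 1 + endSum R.path f

theorem fundamental_mem_cycleSpace {f : Sym2 V} (hf : f ∈ G.edgeSet) :
    R.fundamental f ∈ cycleSpace G := by
  refine mem_cycleSpace.2 ⟨?_, ?_⟩
  · rw [← Finsupp.mem_supported (ZMod 2)]
    refine add_mem (single_mem_supported _ _ hf) ?_
    induction f with | _ x y =>
    exact add_mem (R.support_subset x) (R.support_subset y)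
  · induction f with | _ x y =>
    rw [fundamental, endSum_mk, map_add, map_add, boundary_single, R.boundary_path,
      R.boundary_path, id, endSum_mk, add_comm (single R.root 1), ZModModule.add_add_add_cancel,
      ZModModule.add_self]

theorem card_support_fundamental_le (f : Sym2 V) :
    #(R.fundamental f).support ≤ 2 * G.diam + 1 := by
  induction f with | _ x y =>
  have hxy := card_support_add_le (single s(x, y) 1) (R.path x + R.path y)
  have hP := card_support_add_le (R.path x) (R.path y)
  have hf := card_le_card (support_single_subset (a := s(x, y)) (b := (1 : ZMod 2)))
  have hx := R.card_support_le x
  have hy := R.card_support_le y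
  rw [card_singleton] at hf
  rw [fundamental, endSum_mk]
  omega

theorem card_support_sum_fundamental_le (S : Finset (Sym2 V)) :
    #(∑ f ∈ S, R.fundamental f).support ≤ #S * (2 * G.diam + 1) := by
  classical
  calc #(∑ f ∈ S, R.fundamental f).support ≤ #(S.biUnion fun f => (R.fundamental f).support) :=
        card_le_card support_finsetSum
    _ ≤ #S * (2 * G.diam + 1) :=
        card_biUnion_le_card_mul _ _ _ fun f _ => R.card_support_fundamental_le f

theorem sum_fundamental {S : Finset (Sym2 V)} (hS : boundary id (chain S) = 0) :
    ∑ f ∈ S, R.fundamental f = chain S := by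
  have hpaths : ∑ f ∈ S, endSum R.path f = 0 := sum_endSum_eq_zero hS R.path
  simp only [fundamental, sum_add_distrib]
  rw [hpaths, add_zero, chain]

theorem sum_fundamental_apply (S : Finset (Sym2 V)) {I : Set α} {e : Sym2 V}
    (hI : ∀ v, R.path v e = I.indicator 1 (R.label v)) :
    (∑ f ∈ S, R.fundamental f) e = chain S e + endParity (Sym2.map R.label) I S := by
  have hends : ∀ f : Sym2 V, endSum R.path f e = endSum (I.indicator 1) (f.map R.label) := by
    intro f
    induction f with | _ x y =>
    simp [hI]
  simp only [fundamental, sum_add_distrib, Finsupp.add_apply, Finsupp.finsetSum_apply, hends,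
    chain, endParity]

end Preorder

theorem exists_finset_cycleSpace [LinearOrder α] (R : RootPaths G α) {z : Sym2 V →₀ ZMod 2}
    (hz : z ∈ cycleSpace G) : ∃ Q : Finset (Sym2 V →₀ ZMod 2),
      (∀ y ∈ Q, y ∈ cycleSpace G ∧
        #y.support ≤ (2 * Nat.log 2 #z.support + 3) * (2 * G.diam + 1)) ∧
      (∀ e, z e ≠ 0 → ∃ y ∈ Q, y e ≠ 0) ∧
      ∀ e, #{y ∈ Q | y e ≠ 0} ≤ 32 * Nat.log 2 #z.support + 17 := by
  classical
  obtain ⟨hzG, hz0⟩ := mem_cycleSpace.1 hz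
  obtain ⟨P, hPcard, hPodd⟩ := exists_grouping_ordConnected (Sym2.map R.label) z.support
  refine ⟨P.parts.image fun S => ∑ f ∈ S, R.fundamental f, ?_, fun e he => ?_, fun e => ?_⟩
  · rw [forall_mem_image]
    refine fun S hS => ⟨sum_mem fun f hf => ?_, ?_⟩
    · exact R.fundamental_mem_cycleSpace (hzG (P.le hS hf))
    · exact (R.card_support_sum_fundamental_le S).trans (Nat.mul_le_mul_right _ (hPcard S hS))
  · have hsum : ∑ S ∈ P.parts, ∑ f ∈ S, R.fundamental f = z := by
      refine (sum_biUnion P.disjoint).symm.trans ?_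
      rw [P.biUnion_parts, R.sum_fundamental (by rwa [chain_support]), chain_support]
    rw [← hsum, Finsupp.finsetSum_apply] at he
    obtain ⟨S, hS, hSe⟩ := exists_ne_zero_of_sum_ne_zero he
    exact ⟨_, mem_image_of_mem _ hS, hSe⟩
  · obtain ⟨I, hI, hPI⟩ := R.exists_ordConnected e
    have hsub : {S ∈ P.parts | (∑ f ∈ S, R.fundamental f) e ≠ 0} ⊆
        {S ∈ P.parts | e ∈ S} ∪ {S ∈ P.parts | endParity (Sym2.map R.label) I S ≠ 0} := by
      rw [← filter_or]
      refine monotone_filter_right _ fun S _ hne => ?_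
      by_contra! h
      rw [R.sum_fundamental_apply S hPI, chain_apply, if_neg h.1, h.2, add_zero] at hne
      exact hne rfl
    have hone : #{S ∈ P.parts | e ∈ S} ≤ 1 := by
      refine card_le_one.2 fun S hS T hT => ?_
      obtain ⟨hS, heS⟩ := mem_filter.1 hS
      obtain ⟨hT, heT⟩ := mem_filter.1 hT
      exact P.eq_of_mem_parts hS hT heS heT
    rw [filter_image]
    calc _ ≤ _ := card_image_le
      _ ≤ _ := card_le_card hsub
      _ ≤ _ := card_union_le _ _
      _ ≤ _ := add_le_add hone (hPodd I hI)
      _ = _ := by ring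

end RootPaths

theorem hasCycleCover_of_isCycleEdges {d c : ℕ} (Q : Finset (Finset (Sym2 V)))
    (hQ : ∀ S ∈ Q, IsCycleEdges G S ∧ #S ≤ d) (hcov : ∀ e ∈ G.edgeSet, ∃ S ∈ Q, e ∈ S)
    (hcon : ∀ e ∈ G.edgeSet, {S | S ∈ Q ∧ e ∈ S}.ncard ≤ c) : HasCycleCover G d c := by
  classical
  choose v p hp hmem using fun i => (hQ _ (Q.equivFin.symm i).2).1
  refine ⟨#Q, v, p, hp, fun i => ?_, fun e he => ⟨?_, ?_⟩⟩
  · have hedges : (Q.equivFin.symm i : Finset (Sym2 V)) = (p i).edges.toFinset := by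
      ext e
      rw [hmem, List.mem_toFinset]
    rw [← SimpleGraph.Walk.length_edges,
      ← List.toFinset_card_of_nodup (hp i).isCircuit.isTrail.edges_nodup, ← hedges]
    exact (hQ _ (Q.equivFin.symm i).2).2
  · obtain ⟨S, hS, heS⟩ := hcov e he
    exact ⟨Q.equivFin ⟨S, hS⟩, (hmem _ e).1 (by simpa using heS)⟩
  · refine le_trans (Set.ncard_le_ncard_of_injOn
      (fun i => (Q.equivFin.symm i : Finset (Sym2 V))) (fun i hi => ?_) ?_ ?_) (hcon e he)
    · exact ⟨(Q.equivFin.symm i).2, (hmem i e).2 hi⟩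
    · exact (Subtype.val_injective.comp Q.equivFin.symm.injective).injOn
    · exact Q.finite_toSet.subset fun S hS => hS.1

theorem hasCycleCover_of_cycleSpace {d c : ℕ} (Q : Finset (Sym2 V →₀ ZMod 2))
    (hQ : ∀ z ∈ Q, z ∈ cycleSpace G ∧ #z.support ≤ d)
    (hcov : ∀ e ∈ G.edgeSet, ∃ z ∈ Q, z e ≠ 0)
    (hcon : ∀ e ∈ G.edgeSet, #{z ∈ Q | z e ≠ 0} ≤ c) : HasCycleCover G d c := by
  classical
  have hpart (z : Sym2 V →₀ ZMod 2) : ∃ P : Finpartition z.support, z ∈ cycleSpace G →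
      ∀ S ∈ P.parts, IsCycleEdges G S := by
    by_cases hz : z ∈ cycleSpace G
    · exact (exists_finpartition_isCycleEdges (by rwa [chain_support])).imp fun P hP _ => hP
    · exact ⟨⊥, fun h => absurd h hz⟩
  choose P hP using hpart
  refine hasCycleCover_of_isCycleEdges (Q.biUnion fun z => (P z).parts) (fun S hS => ?_)
    (fun e he => ?_) fun e he => ?_
  · obtain ⟨z, hz, hS⟩ := mem_biUnion.1 hS
    exact ⟨hP z (hQ z hz).1 S hS, (card_le_card ((P z).le hS)).trans (hQ z hz).2⟩
  · obtain ⟨z, hz, hze⟩ := hcov e he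
    obtain ⟨S, hS, heS⟩ := (P z).exists_mem (mem_support_iff.2 hze)
    exact ⟨S, mem_biUnion.2 ⟨z, hz, hS⟩, heS⟩
  · refine le_trans ?_ (hcon e he)
    rw [← coe_filter, Set.ncard_coe_finset]
    refine card_le_card_of_forall_subsingleton (fun S z => S ∈ (P z).parts) (fun S hS => ?_) ?_
    · obtain ⟨hS, heS⟩ := mem_filter.1 hS
      obtain ⟨z, hz, hSz⟩ := mem_biUnion.1 hS
      exact ⟨z, mem_filter.2 ⟨hz, mem_support_iff.1 ((P z).le hSz heS)⟩, hSz⟩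
    · rintro z - S ⟨hS, hSz⟩ T ⟨hT, hTz⟩
      exact (P z).eq_of_mem_parts hSz hTz (mem_filter.1 hS).2 (mem_filter.1 hT).2

theorem IsBridgeless.hasCycleCover [Finite V] (hG : IsBridgeless G) {q : ℕ}
    (hq : Nat.log 2 G.edgeSet.ncard ≤ q) :
    HasCycleCover G ((2 * q + 3) * (2 * G.diam + 1)) ((q + 1) * (32 * q + 17)) := by
  classical
  let _ : LinearOrder V := linearOrderOfSTO WellOrderingRel
  have : Finite (Sym2 V →₀ ZMod 2) := DFunLike.finite _
  obtain ⟨R⟩ := nonempty_rootPaths hG.1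
  have hfin : G.edgeSet.Finite := Set.toFinite _
  obtain ⟨Z, hZcard, hZ, hcov⟩ := exists_cover_of_card_lt_two_pow (W := cycleSpace G)
    (A := hfin.toFinset) (k := q + 1) (fun e he => hG.exists_mem_cycleSpace (by simpa using he)) (by
      rw [← Set.ncard_eq_toFinset_card]
      exact Nat.lt_pow_of_log_lt one_lt_two (Nat.lt_succ_iff.2 hq))
  have hlog : ∀ z ∈ Z, Nat.log 2 #z.support ≤ q := by
    intro z hz
    refine (Nat.log_mono_right ?_).trans hq
    rw [← Set.ncard_coe_finset]
    exact Set.ncard_le_ncard (mem_cycleSpace.1 (hZ z hz)).1 hfin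
  choose! Q hQ hQcov hQcon using fun z hz => R.exists_finset_cycleSpace (hZ z hz)
  refine hasCycleCover_of_cycleSpace (Z.biUnion Q) (fun y hy => ?_) (fun e he => ?_) fun e _ => ?_
  · obtain ⟨z, hz, hy⟩ := mem_biUnion.1 hy
    exact ⟨(hQ z hz y hy).1, (hQ z hz y hy).2.trans (by gcongr; exact hlog z hz)⟩
  · obtain ⟨z, hz, hze⟩ := hcov e (by simpa using he)
    obtain ⟨y, hy, hye⟩ := hQcov z hz e hze
    exact ⟨y, mem_biUnion.2 ⟨z, hz, hy⟩, hye⟩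
  · rw [filter_biUnion]
    calc _ ≤ #Z * (32 * q + 17) := card_biUnion_le_card_mul _ _ _ fun z hz =>
          (hQcon z hz e).trans (by gcongr; exact hlog z hz)
      _ ≤ _ := Nat.mul_le_mul_right _ hZcard

end CycleCover

/-! ### The gadget graph -/

section Gadget

variable {V L : Type*} (G : SimpleGraph V) (κ : V → V → L)

/-- A node of the gadget graph: a vertex `u` of `G` together with the `κ u`-label of one of its
neighbors. -/
def GadgetNode : Type _ := {x : V × L // ∃ v, G.Adj x.1 v ∧ κ x.1 v = x.2}

variable {G κ}

namespace GadgetNode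

/-- The vertex of the original graph to which a gadget node belongs. -/
def base (x : GadgetNode G κ) : V := x.1.1

/-- The label of a gadget node, which stands for a class of neighbors of its base. -/
def label (x : GadgetNode G κ) : L := x.1.2

variable (κ) in
/-- The node of the gadget of `u` that represents the class of the neighbor `v`. -/
def ofAdj {u v : V} (h : G.Adj u v) : GadgetNode G κ := ⟨(u, κ u v), v, h, rfl⟩

theorem ext {x y : GadgetNode G κ} (hb : x.base = y.base) (hl : x.label = y.label) : x = y :=
  Subtype.ext (Prod.ext hb hl)

theorem exists_eq_ofAdj (x : GadgetNode G κ) : ∃ (v : V) (h : G.Adj x.base v), x = ofAdj κ h := by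
  obtain ⟨v, h, hl⟩ := x.2
  exact ⟨v, h, ext rfl hl.symm⟩

theorem surjective_ofAdj_adj : Function.Surjective fun d : G.Dart => ofAdj κ d.adj := by
  intro x
  obtain ⟨v, h, hx⟩ := x.exists_eq_ofAdj
  exact ⟨⟨(_, v), h⟩, hx.symm⟩

instance finite [Finite V] : Finite (GadgetNode G κ) := by
  classical
  have := Fintype.ofFinite V
  exact Finite.of_surjective _ surjective_ofAdj_adj

end GadgetNode

open GadgetNode

theorem card_gadgetNode_le [Finite V] : Nat.card (GadgetNode G κ) ≤ 2 * G.edgeSet.ncard := by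
  classical
  have := Fintype.ofFinite V
  rw [← SimpleGraph.coe_edgeFinset, Set.ncard_coe_finset,
    ← SimpleGraph.dart_card_eq_twice_card_edges, ← Nat.card_eq_fintype_card]
  exact Nat.card_le_card_of_surjective _ surjective_ofAdj_adj

variable (κ) {nb : V → V} (hnb : ∀ u, G.Adj u (nb u))

/-- The center of the gadget of `u`, which represents the class of the chosen neighbor `nb u`. -/
def hubNode (u : V) : GadgetNode G κ := ofAdj κ (hnb u)

/-- The gadget graph: each vertex `u` is replaced by a star with one node for each class of
neighbors of `u`, and an edge `uv` of `G` joins the nodes of the classes of `v` at `u` and of `u`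
at `v`. -/
def gadgetGraph : SimpleGraph (GadgetNode G κ) where
  Adj x y := (x.base = y.base ∧ x ≠ y ∧ (x = hubNode κ hnb x.base ∨ y = hubNode κ hnb y.base)) ∨
    (G.Adj x.base y.base ∧ κ x.base y.base = x.label ∧ κ y.base x.base = y.label)
  symm := ⟨by
    rintro x y (⟨hb, hne, hhub⟩ | ⟨hadj, hx, hy⟩)
    · exact Or.inl ⟨hb.symm, hne.symm, hhub.symm⟩
    · exact Or.inr ⟨hadj.symm, hy, hx⟩⟩
  loopless := ⟨by
    rintro x (⟨-, h, -⟩ | ⟨h, -, -⟩)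
    · exact h rfl
    · exact h.ne rfl⟩

variable {κ}

theorem gadgetGraph_adj_hubNode {x : GadgetNode G κ} (hx : x ≠ hubNode κ hnb x.base) :
    (gadgetGraph κ hnb).Adj x (hubNode κ hnb x.base) :=
  Or.inl ⟨rfl, hx, Or.inr rfl⟩

theorem gadgetGraph_adj_ofAdj {u v : V} (h : G.Adj u v) :
    (gadgetGraph κ hnb).Adj (ofAdj κ h) (ofAdj κ h.symm) :=
  Or.inr ⟨h, rfl, rfl⟩

theorem exists_walk_hubNode (x : GadgetNode G κ) :
    ∃ p : (gadgetGraph κ hnb).Walk x (hubNode κ hnb x.base), p.length ≤ 1 := by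
  by_cases hx : x = hubNode κ hnb x.base
  · exact ⟨SimpleGraph.Walk.nil.copy rfl hx, by simp⟩
  · exact ⟨(gadgetGraph_adj_hubNode hnb hx).toWalk, by simp⟩

theorem exists_walk_of_base_eq {x y : GadgetNode G κ} (h : x.base = y.base) :
    ∃ p : (gadgetGraph κ hnb).Walk x y, p.length ≤ 2 := by
  obtain ⟨p, hp⟩ := exists_walk_hubNode hnb x
  obtain ⟨q, hq⟩ := h ▸ exists_walk_hubNode hnb y
  refine ⟨p.append q.reverse, ?_⟩
  rw [SimpleGraph.Walk.length_append, SimpleGraph.Walk.length_reverse]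
  exact add_le_add hp hq

theorem exists_gadgetGraph_walk {u v : V} (p : G.Walk u v) (x y : GadgetNode G κ)
    (hx : x.base = u) (hy : y.base = v) :
    ∃ q : (gadgetGraph κ hnb).Walk x y, q.length ≤ 3 * p.length + 2 := by
  induction p generalizing x with
  | nil => exact exists_walk_of_base_eq hnb (hx.trans hy.symm)
  | cons h p ih =>
    obtain ⟨q₁, h₁⟩ := exists_walk_of_base_eq hnb (x := x) (y := ofAdj κ h) hx
    obtain ⟨q₂, h₂⟩ := ih (ofAdj κ h.symm) rfl hy
    refine ⟨q₁.append (.cons (gadgetGraph_adj_ofAdj hnb h) q₂), ?_⟩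
    rw [SimpleGraph.Walk.length_append, SimpleGraph.Walk.length_cons,
      SimpleGraph.Walk.length_cons]
    omega

theorem gadgetGraph_connected (hG : G.Connected) : (gadgetGraph κ hnb).Connected := by
  have : Nonempty (GadgetNode G κ) := hG.nonempty.map (hubNode κ hnb)
  refine ⟨fun x y => ?_⟩
  obtain ⟨p⟩ := hG.preconnected x.base y.base
  obtain ⟨q, -⟩ := exists_gadgetGraph_walk hnb p x y rfl rfl
  exact ⟨q⟩

theorem gadgetGraph_diam_le [Finite V] (hG : G.Connected) :
    (gadgetGraph κ hnb).diam ≤ 3 * G.diam + 2 := by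
  have : Nonempty V := hG.nonempty
  have := (gadgetGraph_connected (κ := κ) hnb hG).nonempty
  obtain ⟨x, y, hxy⟩ := (gadgetGraph κ hnb).exists_dist_eq_diam
  obtain ⟨p, hp⟩ := hG.exists_walk_length_eq_dist x.base y.base
  obtain ⟨q, hq⟩ := exists_gadgetGraph_walk hnb p x y rfl rfl
  have hdist : G.dist x.base y.base ≤ G.diam :=
    SimpleGraph.dist_le_diam (SimpleGraph.connected_iff_ediam_ne_top.1 hG)
  rw [← hxy]
  exact (SimpleGraph.dist_le q).trans (hq.trans (by omega))

theorem reachable_of_induce_reachable {X : Set V} {K : SimpleGraph (GadgetNode G κ)}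
    (hK : ∀ x y, (gadgetGraph κ hnb).Adj x y → x.base ∈ X → y.base ∈ X → K.Adj x y)
    {u v : X} (huv : (G.induce X).Reachable u v) (x y : GadgetNode G κ) (hx : x.base = u)
    (hy : y.base = v) : K.Reachable x y := by
  have hub (z : GadgetNode G κ) (hz : z.base ∈ X) : K.Reachable z (hubNode κ hnb z.base) := by
    by_cases h : z = hubNode κ hnb z.base
    · rw [← h]
    · exact (hK _ _ (gadgetGraph_adj_hubNode hnb h) hz hz).reachable
  have same {z w : GadgetNode G κ} (h : z.base = w.base) (hz : z.base ∈ X) : K.Reachable z w :=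
    (hub z hz).trans (h ▸ hub w (h ▸ hz)).symm
  obtain ⟨p⟩ := huv
  induction p generalizing x with
  | nil => exact same (hx.trans hy.symm) (hx ▸ Subtype.coe_prop _)
  | @cons u w v h _ ih =>
    have h : G.Adj u w := h
    have hlink : K.Adj (ofAdj κ h) (ofAdj κ h.symm) :=
      hK _ _ (gadgetGraph_adj_ofAdj hnb h) u.2 w.2
    exact (same hx (hx ▸ u.2)).trans (hlink.reachable.trans (ih (ofAdj κ h.symm) rfl hy))

section DeleteEdges

variable {x y : GadgetNode G κ}

theorem deleteEdges_gadgetGraph_adj {z w : GadgetNode G κ} (h : (gadgetGraph κ hnb).Adj z w)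
    (hne : s(z.base, w.base) ≠ s(x.base, y.base)) :
    ((gadgetGraph κ hnb).deleteEdges {s(x, y)}).Adj z w :=
  SimpleGraph.deleteEdges_adj.2 ⟨h, fun h => hne (congrArg (Sym2.map base) h)⟩

theorem deleteEdges_gadgetGraph_adj_ofAdj {u v : V} (h : G.Adj u v)
    (hne : s(u, v) ≠ s(x.base, y.base)) :
    ((gadgetGraph κ hnb).deleteEdges {s(x, y)}).Adj (ofAdj κ h) (ofAdj κ h.symm) :=
  deleteEdges_gadgetGraph_adj hnb (gadgetGraph_adj_ofAdj hnb h) hne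

theorem deleteEdges_gadgetGraph_reachable (hG : IsTwoVertexConnected G) {z w : GadgetNode G κ}
    (hz : z.base ≠ x.base) (hw : w.base ≠ x.base) :
    ((gadgetGraph κ hnb).deleteEdges {s(x, y)}).Reachable z w := by
  refine reachable_of_induce_reachable hnb (X := {x.base}ᶜ) (fun a b hab ha hb => ?_)
    ((hG.2 x.base).preconnected ⟨z.base, hz⟩ ⟨w.base, hw⟩) z w rfl rfl
  refine deleteEdges_gadgetGraph_adj hnb hab fun h => ?_
  rcases Sym2.eq_iff.1 h with ⟨h, -⟩ | ⟨-, h⟩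
  · exact ha h
  · exact hb h

theorem deleteEdges_gadgetGraph_reachable_of_base_eq (hG : IsTwoVertexConnected G)
    (hb : x.base = y.base) :
    ((gadgetGraph κ hnb).deleteEdges {s(x, y)}).Reachable x y := by
  have leave (z : GadgetNode G κ) (hz : z.base = x.base) : ∃ w : GadgetNode G κ,
      w.base ≠ x.base ∧ ((gadgetGraph κ hnb).deleteEdges {s(x, y)}).Adj z w := by
    obtain ⟨v, hv, hzv⟩ := z.exists_eq_ofAdj
    refine ⟨ofAdj κ hv.symm, hz ▸ hv.ne', ?_⟩
    have h := deleteEdges_gadgetGraph_adj_ofAdj hnb hv (x := x) (y := y) fun h => by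
      rw [← hb, hz] at h
      exact hv.ne (hz.trans (Sym2.congr_right.1 h).symm)
    rwa [← hzv] at h
  obtain ⟨x', hx', hxx'⟩ := leave x rfl
  obtain ⟨y', hy', hyy'⟩ := leave y hb.symm
  exact hxx'.reachable.trans
    ((deleteEdges_gadgetGraph_reachable hnb hG hx' hy').trans hyy'.symm.reachable)

theorem deleteEdges_gadgetGraph_reachable_of_adj (hG : IsTwoVertexConnected G)
    (hdeg : ∀ u v, G.Adj u v → ∃ w, w ≠ v ∧ G.Adj u w) (hadj : G.Adj x.base y.base) :
    ((gadgetGraph κ hnb).deleteEdges {s(x, y)}).Reachable x y := by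
  obtain ⟨w, hwy, hw⟩ := hdeg _ _ hadj
  have hstar : ((gadgetGraph κ hnb).deleteEdges {s(x, y)}).Reachable x (ofAdj κ hw) := by
    refine reachable_of_induce_reachable hnb (X := {x.base}) (u := ⟨x.base, rfl⟩)
      (v := ⟨x.base, rfl⟩) (fun a b hab ha hb => ?_) (SimpleGraph.Reachable.refl _) _ _ rfl rfl
    refine deleteEdges_gadgetGraph_adj hnb hab fun h => ?_
    rw [Set.mem_singleton_iff.1 ha, Set.mem_singleton_iff.1 hb] at h
    exact hadj.ne (Sym2.congr_right.1 h)
  have hlink : ((gadgetGraph κ hnb).deleteEdges {s(x, y)}).Adj (ofAdj κ hw) (ofAdj κ hw.symm) :=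
    deleteEdges_gadgetGraph_adj_ofAdj hnb hw fun h => hwy (Sym2.congr_right.1 h)
  exact hstar.trans (hlink.reachable.trans
    (deleteEdges_gadgetGraph_reachable hnb hG hw.ne' hadj.ne'))

end DeleteEdges

theorem isBridgeless_of_reachable {W : Type*} {H : SimpleGraph W} (hH : H.Connected)
    (h : ∀ x y, H.Adj x y → (H.deleteEdges {s(x, y)}).Reachable x y) : IsBridgeless H := by
  refine ⟨hH, fun e he => ?_⟩
  induction e with | _ x y =>
  refine hH.connected_delete_edge_of_not_isBridge ?_
  rw [SimpleGraph.isBridge_iff, not_not]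
  exact h x y he

theorem gadgetGraph_isBridgeless (hG : IsTwoVertexConnected G)
    (hdeg : ∀ u v, G.Adj u v → ∃ w, w ≠ v ∧ G.Adj u w) : IsBridgeless (gadgetGraph κ hnb) := by
  refine isBridgeless_of_reachable (gadgetGraph_connected hnb hG.1) fun x y hxy => ?_
  rcases hxy with ⟨hb, -, -⟩ | ⟨hadj, -, -⟩
  · exact deleteEdges_gadgetGraph_reachable_of_base_eq hnb hG hb
  · exact deleteEdges_gadgetGraph_reachable_of_adj hnb hG hdeg hadj

end Gadget

section Transport

variable {W W' : Type*} {H : SimpleGraph W} {H' : SimpleGraph W'}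

theorem IsBridgeless.of_iso (f : H ≃g H') (hH : IsBridgeless H) : IsBridgeless H' := by
  refine isBridgeless_of_reachable (f.connected_iff.1 hH.1) fun x y hxy => ?_
  obtain ⟨a, rfl⟩ := f.surjective x
  obtain ⟨b, rfl⟩ := f.surjective y
  let g : H.deleteEdges {s(a, b)} →g H'.deleteEdges {s(f a, f b)} :=
    { toFun := f
      map_rel' := fun {z w} hzw => by
        rw [SimpleGraph.deleteEdges_adj] at hzw ⊢
        exact ⟨f.map_adj_iff.2 hzw.1, fun h => hzw.2 (Sym2.map.injective f.injective h)⟩ }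
  exact ((hH.2 s(a, b) (f.map_adj_iff.1 hxy)).preconnected a b).map g

theorem diam_le_of_surjective [Finite W] (hH : H.Connected) (f : H →g H')
    (hf : Function.Surjective f) : H'.diam ≤ H.diam := by
  have : Nonempty W := hH.nonempty
  have : Nonempty W' := this.map f
  obtain ⟨x, y, hxy⟩ := H'.exists_dist_eq_diam
  obtain ⟨a, rfl⟩ := hf x
  obtain ⟨b, rfl⟩ := hf y
  obtain ⟨p, hp⟩ := hH.exists_walk_length_eq_dist a b
  calc H'.diam = H'.dist (f a) (f b) := hxy.symm
    _ ≤ (p.map f).length := SimpleGraph.dist_le _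
    _ = H.dist a b := by rw [SimpleGraph.Walk.length_map, hp]
    _ ≤ H.diam := SimpleGraph.dist_le_diam (SimpleGraph.connected_iff_ediam_ne_top.1 hH)

theorem HasCycleCover.of_iso (f : H ≃g H') {d c : ℕ} (h : HasCycleCover H d c) :
    HasCycleCover H' d c := by
  obtain ⟨k, v, p, hp, hd, hc⟩ := h
  refine ⟨k, fun i => f (v i), fun i => (p i).map f.toHom, fun i => (hp i).map f.injective,
    fun i => (SimpleGraph.Walk.length_map _ _).trans_le (hd i), fun e he => ?_⟩
  obtain ⟨e, rfl⟩ : ∃ e', e'.map f = e := ⟨e.map f.symm, by simp [Sym2.map_map]⟩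
  have hmem (i) : e.map f ∈ ((p i).map f.toHom).edges ↔ e ∈ (p i).edges := by
    rw [SimpleGraph.Walk.edges_map]
    exact List.mem_map_of_injective (Sym2.map.injective f.injective)
  have he : e ∈ H.edgeSet := by
    induction e with | _ x y =>
    exact f.map_adj_iff.1 he
  simpa only [hmem] using hc e he

end Transport

section Merging

open GadgetNode

theorem HasCycleCover.exists_isCycleEdges {W : Type*} {H : SimpleGraph W} {d c : ℕ}
    (h : HasCycleCover H d c) : ∃ Q : Finset (Finset (Sym2 W)),
      (∀ S ∈ Q, IsCycleEdges H S ∧ #S ≤ d) ∧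
      ∀ e ∈ H.edgeSet, (∃ S ∈ Q, e ∈ S) ∧ {S | S ∈ Q ∧ e ∈ S}.ncard ≤ c := by
  classical
  obtain ⟨k, v, p, hp, hd, hc⟩ := h
  refine ⟨univ.image fun i => (p i).edges.toFinset, ?_, fun e he => ⟨?_, ?_⟩⟩
  · rw [forall_mem_image]
    refine fun i _ => ⟨⟨v i, p i, hp i, fun e => List.mem_toFinset⟩, ?_⟩
    exact (List.toFinset_card_le _).trans ((p i).length_edges.trans_le (hd i))
  · obtain ⟨i, hi⟩ := (hc e he).1
    exact ⟨_, mem_image_of_mem _ (mem_univ i), List.mem_toFinset.2 hi⟩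
  · refine (Set.ncard_le_ncard (t := (fun i => (p i).edges.toFinset) '' {i | e ∈ (p i).edges})
      ?_ (Set.toFinite _)).trans ((Set.ncard_image_le (Set.toFinite _)).trans (hc e he).2)
    rintro S ⟨hS, heS⟩
    obtain ⟨i, -, rfl⟩ := mem_image.1 hS
    exact ⟨i, List.mem_toFinset.1 heS, rfl⟩

theorem exists_walk_of_isCycle {W : Type*} {H : SimpleGraph W} {v : W} {p : H.Walk v v}
    (hp : p.IsCycle) {x z : W} (hxz : s(x, z) ∈ p.edges) :
    ∃ (y : W) (q : H.Walk y z), y ≠ z ∧ H.Adj x y ∧ x ∉ q.support ∧ q.edges ⊆ p.edges := by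
  classical
  have hx := p.fst_mem_support_of_mem_edges hxz
  have hcycle := hp.rotate hx
  have hedges := fun e => (p.rotate_edges x hx).mem_iff (a := e)
  have hxz' := (hedges _).2 hxz
  generalize p.rotate x hx = c at hcycle hedges hxz'
  cases c with
  | nil => exact absurd hcycle SimpleGraph.Walk.not_isCycle_nil
  | @cons _ y _ hxy q =>
    obtain ⟨hq, hxyq⟩ := (SimpleGraph.Walk.cons_isCycle_iff q hxy).1 hcycle
    have hqp : q.edges ⊆ p.edges := fun e he => (hedges e).1 (List.mem_cons_of_mem _ he)
    rcases List.mem_cons.1 hxz' with h | hxzq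
    · obtain rfl := Sym2.congr_right.1 h
      have hr := hq.reverse
      have hrq : q.reverse.edges ⊆ q.edges := by simp
      generalize q.reverse = r at hr hrq
      cases r with
      | nil => exact absurd rfl hxy.ne
      | @cons _ y _ hxy r =>
        refine ⟨y, r, ?_, hxy, ((SimpleGraph.Walk.cons_isPath_iff hxy r).1 hr).2,
          fun e he => hqp (hrq (List.mem_cons_of_mem _ he))⟩
        rintro rfl
        exact hxyq (hrq List.mem_cons_self)
    · have hxz : x ≠ z := (p.adj_of_mem_edges hxz).ne
      have hzq := q.snd_mem_support_of_mem_edges hxzq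
      refine ⟨y, q.takeUntil z hzq, ?_, hxy,
        SimpleGraph.Walk.endpoint_notMem_support_takeUntil hq hzq hxz, fun e he =>
          hqp (q.edges_takeUntil_subset_edges hzq he)⟩
      rintro rfl
      exact hxyq hxzq

variable {V L : Type*} {G : SimpleGraph V} {κ : V → V → L} {nb : V → V}
  (hnb : ∀ u, G.Adj u (nb u))

theorem injOn_map_base : Set.InjOn (Sym2.map base)
    {f : Sym2 (GadgetNode G κ) | f ∈ (gadgetGraph κ hnb).edgeSet ∧ f.map base ∈ G.edgeSet} := by
  have hlabel {x y : GadgetNode G κ} (h : (gadgetGraph κ hnb).Adj x y)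
      (hadj : G.Adj x.base y.base) : x.label = κ x.base y.base := by
    rcases h with ⟨hb, -⟩ | ⟨-, h, -⟩
    · exact absurd hb hadj.ne
    · exact h.symm
  have heq {x y x' y' : GadgetNode G κ} (h : (gadgetGraph κ hnb).Adj x y)
      (hadj : G.Adj x.base y.base) (h' : (gadgetGraph κ hnb).Adj x' y') (hx : x.base = x'.base)
      (hy : y.base = y'.base) : x = x' :=
    GadgetNode.ext hx (by rw [hlabel h hadj, hlabel h' (hx ▸ hy ▸ hadj), hx, hy])
  rintro ⟨x, y⟩ ⟨h, hadj⟩ ⟨x', y'⟩ ⟨h', -⟩ hbase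
  rcases Sym2.eq_iff.1 hbase with ⟨hx, hy⟩ | ⟨hx, hy⟩
  · exact congrArg₂ (s(·, ·)) (heq h hadj h' hx hy) (heq h.symm hadj.symm h'.symm hy hx)
  · exact (congrArg₂ (s(·, ·)) (heq h hadj h'.symm hx hy)
      (heq h.symm hadj.symm h' hy hx)).trans Sym2.eq_swap

theorem exists_reachable_of_gadgetGraph_walk {R : Set (Sym2 V)} {x y z : GadgetNode G κ}
    (q : (gadgetGraph κ hnb).Walk y z)
    (hR : ∀ f ∈ q.edges, f.map base ∈ G.edgeSet → x.base ∉ f.map base → f.map base ∈ R)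
    (hz : z.base = x.base) (hy : y.base ≠ x.base) (hq : x ∉ q.support) :
    ∃ w, G.Adj x.base w ∧ κ x.base w ≠ x.label ∧
      (SimpleGraph.fromEdgeSet R).Reachable y.base w := by
  induction q with
  | nil => exact absurd hz hy
  | @cons y y' z hadj q ih =>
    rw [SimpleGraph.Walk.support_cons, List.mem_cons, not_or] at hq
    rw [SimpleGraph.Walk.edges_cons, List.forall_mem_cons] at hR
    rcases hadj with ⟨hb, -⟩ | ⟨hG, -, hlabel⟩
    · rw [hb] at hy ⊢
      exact ih hR.2 hz hy hq.2
    · by_cases hy' : y'.base = x.base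
      · rw [hy'] at hG hlabel
        refine ⟨y.base, hG.symm, fun h => hq.2 ?_, SimpleGraph.Reachable.refl _⟩
        rw [GadgetNode.ext hy'.symm (h.symm.trans hlabel)]
        exact q.start_mem_support
      · obtain ⟨w, hw, hwx, hreach⟩ := ih hR.2 hz hy' hq.2
        have hmem : s(y.base, y'.base) ∈ R :=
          hR.1 hG (by simpa [Sym2.mem_iff] using ⟨Ne.symm hy, Ne.symm hy'⟩)
        exact ⟨w, hw, hwx,
          ((SimpleGraph.fromEdgeSet_adj R).2 ⟨hmem, hG.ne⟩).reachable.trans hreach⟩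

theorem exists_reachable_of_isCycleEdges {x : GadgetNode G κ} (hx : x ≠ hubNode κ hnb x.base)
    {S : Finset (Sym2 (GadgetNode G κ))} (hS : IsCycleEdges (gadgetGraph κ hnb) S)
    (hxS : s(x, hubNode κ hnb x.base) ∈ S) {R : Set (Sym2 V)}
    (hR : ∀ f ∈ S, f.map base ∈ G.edgeSet → x.base ∉ f.map base → f.map base ∈ R) :
    ∃ v w, G.Adj x.base v ∧ κ x.base v = x.label ∧ G.Adj x.base w ∧ κ x.base w ≠ x.label ∧
      (SimpleGraph.fromEdgeSet R).Reachable v w := by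
  obtain ⟨v, p, hp, hpS⟩ := hS
  obtain ⟨y, q, hy, hadj, hxq, hqp⟩ := exists_walk_of_isCycle hp ((hpS _).1 hxS)
  rcases hadj with ⟨hb, -, h | h⟩ | ⟨hG, hlabel, -⟩
  · exact absurd h hx
  · exact absurd (h.trans (by rw [hb])) hy
  · obtain ⟨w, hw, hwx, hreach⟩ := exists_reachable_of_gadgetGraph_walk hnb q
      (fun f hf => hR f ((hpS f).2 (hqp hf))) rfl hG.ne' hxq
    exact ⟨y.base, w, hG, hlabel, hw, hwx, hreach⟩

section MergingEdges

variable [Fintype V] [DecidableRel G.Adj]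

open Classical in
/-- The labels of the elements of `N` other than the label of `a`. -/
noncomputable def otherLabels (κ : V → L) (N : Finset V) (a : V) : Finset L :=
  (N.image κ).erase (κ a)

open Classical in
/-- The edges of `G` not containing `u` that correspond to edges of the sets `C x`, where `x` runs
over the non-central nodes of the gadget of `u`. -/
noncomputable def mergingEdges (C : GadgetNode G κ → Finset (Sym2 (GadgetNode G κ))) (u : V) :
    Finset (Sym2 V) :=
  {e ∈ G.edgeFinset | u ∉ e ∧
    ∃ x : GadgetNode G κ, x.base = u ∧ x ≠ hubNode κ hnb x.base ∧ ∃ f ∈ C x, f.map base = e}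

variable {hnb} {C : GadgetNode G κ → Finset (Sym2 (GadgetNode G κ))}

theorem mem_mergingEdges {u : V} {e : Sym2 V} :
    e ∈ mergingEdges hnb C u ↔ e ∈ G.edgeSet ∧ u ∉ e ∧ ∃ x : GadgetNode G κ,
      x.base = u ∧ x ≠ hubNode κ hnb x.base ∧ ∃ f ∈ C x, f.map base = e := by
  classical
  rw [mergingEdges, mem_filter, SimpleGraph.mem_edgeFinset]

theorem card_filter_ne_hubNode_le [Fintype (GadgetNode G κ)] [DecidableEq V]
    [DecidableEq (GadgetNode G κ)] (u : V) :
    #{x : GadgetNode G κ | x.base = u ∧ x ≠ hubNode κ hnb x.base} ≤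
      #(otherLabels (κ u) (G.neighborFinset u) (nb u)) := by
  classical
  refine card_le_card_of_injOn label (fun x hx => ?_) fun x hx y hy h => ?_
  · obtain ⟨-, rfl, hne⟩ := mem_filter.1 hx
    obtain ⟨v, hv, hxv⟩ := x.2
    exact mem_erase.2 ⟨fun h => hne (GadgetNode.ext rfl h),
      mem_image.2 ⟨v, (G.mem_neighborFinset _ _).2 hv, hxv⟩⟩
  · obtain ⟨-, hx, -⟩ := mem_filter.1 hx
    obtain ⟨-, hy, -⟩ := mem_filter.1 hy
    exact GadgetNode.ext (hx.trans hy.symm) h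

theorem card_mergingEdges_le {d : ℕ} (hC : ∀ x, x ≠ hubNode κ hnb x.base → #(C x) ≤ d) (u : V) :
    #(mergingEdges hnb C u) ≤ #(otherLabels (κ u) (G.neighborFinset u) (nb u)) * d := by
  classical
  have := Fintype.ofFinite (GadgetNode G κ)
  have hsub : mergingEdges hnb C u ⊆
      Finset.biUnion {x : GadgetNode G κ | x.base = u ∧ x ≠ hubNode κ hnb x.base}
        fun x => (C x).image (Sym2.map base) := by
    intro e he
    obtain ⟨-, -, x, hxu, hx, f, hf, hfe⟩ := mem_mergingEdges.1 he
    exact mem_biUnion.2 ⟨x, mem_filter.2 ⟨mem_univ x, hxu, hx⟩, mem_image.2 ⟨f, hf, hfe⟩⟩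
  calc _ ≤ _ := card_le_card hsub
    _ ≤ _ := card_biUnion_le_card_mul _ _ d fun x hx =>
      card_image_le.trans (hC x (mem_filter.1 hx).2.2)
    _ ≤ _ := Nat.mul_le_mul_right d (card_filter_ne_hubNode_le u)

theorem ncard_setOf_mem_mergingEdges_le {d c : ℕ} {Q : Finset (Finset (Sym2 (GadgetNode G κ)))}
    (hQd : ∀ S ∈ Q, S.card ≤ d ∧ (S : Set (Sym2 (GadgetNode G κ))) ⊆ (gadgetGraph κ hnb).edgeSet)
    (hQc : ∀ f ∈ (gadgetGraph κ hnb).edgeSet, {S | S ∈ Q ∧ f ∈ S}.ncard ≤ c)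
    (hC : ∀ x, x ≠ hubNode κ hnb x.base → C x ∈ Q ∧ s(x, hubNode κ hnb x.base) ∈ C x)
    (e : Sym2 V) : {u | e ∈ mergingEdges hnb C u}.ncard ≤ c * d := by
  classical
  by_cases he : ∃ f ∈ (gadgetGraph κ hnb).edgeSet, f.map base = e ∧ e ∈ G.edgeSet
  · obtain ⟨f, hf, rfl, hfG⟩ := he
    have hmaps : ∀ u ∈ {u | f.map base ∈ mergingEdges hnb C u}, s(u, u) ∈
        (({S ∈ Q | f ∈ S}.biUnion fun S => S.image (Sym2.map base) : Finset (Sym2 V)) :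
          Set (Sym2 V)) := by
      intro u hu
      obtain ⟨-, -, x, rfl, hx, g, hg, hgf⟩ := mem_mergingEdges.1 hu
      obtain ⟨hxQ, hxC⟩ := hC x hx
      obtain rfl : g = f := injOn_map_base hnb ⟨(hQd _ hxQ).2 hg, hgf ▸ hfG⟩ ⟨hf, hfG⟩ hgf
      exact mem_biUnion.2 ⟨C x, mem_filter.2 ⟨hxQ, hg⟩, mem_image.2 ⟨_, hxC, rfl⟩⟩
    refine (Set.ncard_le_ncard_of_injOn _ hmaps (fun u _ v _ h => ?_)).trans ?_
    · simpa using h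
    · rw [Set.ncard_coe_finset]
      refine (card_biUnion_le_card_mul _ _ d fun S hS =>
        card_image_le.trans (hQd S (mem_filter.1 hS).1).1).trans (Nat.mul_le_mul_right d ?_)
      rw [← Set.ncard_coe_finset, coe_filter]
      exact hQc f hf
  · have hempty : {u | e ∈ mergingEdges hnb C u} = ∅ := by
      refine Set.eq_empty_of_forall_notMem fun u hu => he ?_
      obtain ⟨heG, -, x, -, hx, f, hf, hfe⟩ := mem_mergingEdges.1 hu
      exact ⟨f, (hQd _ (hC x hx).1).2 hf, hfe, heG⟩
    simp [hempty]

theorem exists_merging_edges {d c : ℕ} (hcover : HasCycleCover (gadgetGraph κ hnb) d c) :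
    ∃ R : V → Finset (Sym2 V),
      (∀ u, ∀ e ∈ R u, e ∈ G.edgeSet ∧ u ∉ e) ∧
      (∀ u, #(R u) ≤ #(otherLabels (κ u) (G.neighborFinset u) (nb u)) * d) ∧
      (∀ e, {u | e ∈ R u}.ncard ≤ c * d) ∧
      ∀ u v, G.Adj u v → κ u v ≠ κ u (nb u) → ∃ v' w, G.Adj u v' ∧ κ u v' = κ u v ∧
        G.Adj u w ∧ κ u w ≠ κ u v ∧
        (SimpleGraph.fromEdgeSet (R u : Set (Sym2 V))).Reachable v' w := by
  obtain ⟨Q, hQ, hcov⟩ := hcover.exists_isCycleEdges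
  have hQG : ∀ S ∈ Q, (S : Set (Sym2 (GadgetNode G κ))) ⊆ (gadgetGraph κ hnb).edgeSet := by
    intro S hS f hf
    obtain ⟨v, p, -, hp⟩ := (hQ S hS).1
    exact p.edges_subset_edgeSet ((hp f).1 hf)
  have hC (x : GadgetNode G κ) (hx : x ≠ hubNode κ hnb x.base) :
      ∃ S, S ∈ Q ∧ s(x, hubNode κ hnb x.base) ∈ S :=
    (hcov _ (gadgetGraph_adj_hubNode hnb hx)).1
  choose! C hC using hC
  refine ⟨mergingEdges hnb C, fun u e he => ?_, card_mergingEdges_le fun x hx => ?_,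
    ncard_setOf_mem_mergingEdges_le (fun S hS => ⟨(hQ S hS).2, hQG S hS⟩)
      (fun f hf => (hcov f hf).2) hC, fun u v huv hne => ?_⟩
  · obtain ⟨heG, heu, -⟩ := mem_mergingEdges.1 he
    exact ⟨heG, heu⟩
  · exact (hQ _ (hC x hx).1).2
  · have hx : ofAdj κ huv ≠ hubNode κ hnb u := fun h => hne (congrArg label h)
    obtain ⟨hCQ, hxC⟩ := hC _ hx
    exact exists_reachable_of_isCycleEdges hnb hx (hQ _ hCQ).1 hxC fun f hf hfG hfu =>
      mem_mergingEdges.2 ⟨hfG, hfu, _, rfl, hx, f, hf, rfl⟩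

end MergingEdges

end Merging

section Iteration

variable {V : Type*}

theorem two_mul_card_otherLabels_le {L L' : Type*} (N : Finset V) (κ : V → L) (κ' : V → L') {a : V}
    (hrefine : ∀ v w, κ v = κ w → κ' v = κ' w)
    (hmerge : ∀ v ∈ N, κ v ≠ κ a → ∃ w ∈ N, κ w ≠ κ v ∧ κ' w = κ' v) :
    2 * #(otherLabels κ' N a) ≤ #(otherLabels κ N a) := by
  classical
  rw [mul_comm, ← mul_one #(otherLabels κ N a)]
  refine card_mul_le_card_mul (fun b x => ∃ v ∈ N, κ v = x ∧ κ' v = b) (fun b hb => ?_)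
    fun x _ => card_le_one.2 fun b hb b' hb' => ?_
  · obtain ⟨hne, hb⟩ := mem_erase.1 hb
    obtain ⟨v, hv, rfl⟩ := mem_image.1 hb
    have hva : κ v ≠ κ a := fun h => hne (hrefine _ _ h)
    obtain ⟨w, hw, hwv, hw'⟩ := hmerge v hv hva
    have hwa : κ w ≠ κ a := fun h => hne (hw' ▸ hrefine _ _ h)
    rw [← card_pair hwv]
    refine card_le_card (insert_subset ?_ (singleton_subset_iff.2 ?_))
    · exact (mem_bipartiteAbove _).2 ⟨mem_erase.2 ⟨hwa, mem_image_of_mem _ hw⟩, w, hw, rfl, hw'⟩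
    · exact (mem_bipartiteAbove _).2 ⟨mem_erase.2 ⟨hva, mem_image_of_mem _ hv⟩, v, hv, rfl, rfl⟩
  · obtain ⟨-, v, -, hv, rfl⟩ := (mem_bipartiteBelow _).1 hb
    obtain ⟨-, w, -, hw, rfl⟩ := (mem_bipartiteBelow _).1 hb'
    exact hrefine _ _ (hv.trans hw.symm)

/-- The vertex set of the component of `v` in the graph with edge set `E`. As a set of vertices, it
is a label whose type does not depend on `E`. -/
def componentSet (E : Set (Sym2 V)) (v : V) : Set V :=
  ((SimpleGraph.fromEdgeSet E).connectedComponentMk v).supp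

theorem componentSet_eq_iff {E : Set (Sym2 V)} {v w : V} :
    componentSet E v = componentSet E w ↔ (SimpleGraph.fromEdgeSet E).Reachable v w :=
  SimpleGraph.ConnectedComponent.supp_inj.trans SimpleGraph.ConnectedComponent.eq

theorem componentSet_eq_mono {E F : Set (Sym2 V)} (h : E ⊆ F) {v w : V}
    (hvw : componentSet E v = componentSet E w) : componentSet F v = componentSet F w :=
  componentSet_eq_iff.2 ((componentSet_eq_iff.1 hvw).mono (SimpleGraph.fromEdgeSet_mono h))

variable [Fintype V] {G : SimpleGraph V} [DecidableRel G.Adj] {nb : V → V}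

variable (G nb) in
/-- The number of components of the graph with edge set `E`, other than the component of `nb u`,
that contain a neighbor of `u` in `G`. -/
noncomputable def excess (E : Set (Sym2 V)) (u : V) : ℕ :=
  #(otherLabels (componentSet E) (G.neighborFinset u) (nb u))

theorem excess_le_maxDegree (E : Set (Sym2 V)) (u : V) : excess G nb E u ≤ G.maxDegree := by
  classical
  exact (card_le_card (erase_subset _ _)).trans (card_image_le.trans (G.degree_le_maxDegree u))

theorem reachable_of_excess_eq_zero {E : Set (Sym2 V)} {u v : V} (h : excess G nb E u = 0)
    (hv : G.Adj u v) : (SimpleGraph.fromEdgeSet E).Reachable v (nb u) := by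
  classical
  by_contra hne
  refine (card_pos.2 ⟨componentSet E v, mem_erase.2 ⟨?_, ?_⟩⟩).ne' h
  · exact fun h => hne (componentSet_eq_iff.1 h)
  · exact mem_image_of_mem _ ((G.mem_neighborFinset u v).2 hv)

variable (G nb) in
/-- The state after `t` rounds of merging with `(d, c)`-cycle covers: edge sets `R u` avoiding `u`
that have halved `t` times the number of components containing a neighbor of `u`. -/
structure IsMergingState (d c t : ℕ) (R : V → Finset (Sym2 V)) : Prop where
  edge : ∀ u, ∀ e ∈ R u, e ∈ G.edgeSet ∧ u ∉ e
  excess_mul_two_pow_le : ∀ u, excess G nb (R u) u * 2 ^ t ≤ G.maxDegree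
  -- The `t`-th round adds at most `excess * d` edges, so halving keeps this potential bounded.
  card_add_le : ∀ u, #(R u) + 2 * (excess G nb (R u) u * d) ≤ 2 * (G.maxDegree * d)
  congestion : ∀ e, {u | e ∈ R u}.ncard ≤ t * (c * d)

theorem isMergingState_zero (d c : ℕ) : IsMergingState G nb d c 0 fun _ => ∅ where
  edge := by simp
  excess_mul_two_pow_le u := by simpa using excess_le_maxDegree _ u
  card_add_le u := by
    rw [card_empty, zero_add]
    gcongr
    exact excess_le_maxDegree _ u
  congestion := by simp

theorem IsMergingState.exists_succ {hnb : ∀ u, G.Adj u (nb u)} {d c t : ℕ} {R : V → Finset (Sym2 V)}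
    (hR : IsMergingState G nb d c t R)
    (hcover : HasCycleCover (gadgetGraph (fun u => componentSet (R u)) hnb) d c) :
    ∃ R', IsMergingState G nb d c (t + 1) R' := by
  classical
  obtain ⟨S, hSG, hScard, hScong, hmerge⟩ := exists_merging_edges hcover
  have hhalf (u : V) : 2 * excess G nb (R u ∪ S u : Finset (Sym2 V)) u ≤ excess G nb (R u) u := by
    have hsub : (R u : Set (Sym2 V)) ⊆ (R u ∪ S u : Finset (Sym2 V)) :=
      coe_subset.2 subset_union_left
    refine two_mul_card_otherLabels_le _ _ _ (fun v w => componentSet_eq_mono hsub)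
      fun v hv hne => ?_
    obtain ⟨v', w, -, hv', hw, hwv, hreach⟩ := hmerge u v ((G.mem_neighborFinset u v).1 hv) hne
    refine ⟨w, (G.mem_neighborFinset u w).2 hw, hwv, ?_⟩
    rw [← componentSet_eq_mono hsub hv']
    exact (componentSet_eq_mono (coe_subset.2 subset_union_right)
      (componentSet_eq_iff.2 hreach)).symm
  refine ⟨fun u => R u ∪ S u, fun u e he => ?_, fun u => ?_, fun u => ?_, fun e => ?_⟩
  · exact (mem_union.1 he).elim (hR.edge u e) (hSG u e)
  · calc _ = 2 * excess G nb (R u ∪ S u : Finset (Sym2 V)) u * 2 ^ t := by ring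
      _ ≤ excess G nb (R u) u * 2 ^ t := Nat.mul_le_mul_right _ (hhalf u)
      _ ≤ G.maxDegree := hR.excess_mul_two_pow_le u
  · calc _ ≤ #(R u) + #(S u) + 2 * excess G nb (R u ∪ S u : Finset (Sym2 V)) u * d := by
          rw [mul_assoc]
          gcongr
          exact card_union_le _ _
      _ ≤ #(R u) + excess G nb (R u) u * d + excess G nb (R u) u * d := by
          gcongr
          · exact hScard u
          · exact hhalf u
      _ = #(R u) + 2 * (excess G nb (R u) u * d) := by ring
      _ ≤ 2 * (G.maxDegree * d) := hR.card_add_le u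
  · calc _ = ({u | e ∈ R u} ∪ {u | e ∈ S u}).ncard := by
          simp only [mem_union, Set.ofPred_or]
      _ ≤ t * (c * d) + c * d := (Set.ncard_union_le _ _).trans
          (add_le_add (hR.congestion e) (hScong e))
      _ = (t + 1) * (c * d) := by ring

theorem exists_isMergingState (hnb : ∀ u, G.Adj u (nb u)) {d c : ℕ}
    (hcover : ∀ κ : V → V → Set V, HasCycleCover (gadgetGraph κ hnb) d c) (t : ℕ) :
    ∃ R, IsMergingState G nb d c t R := by
  induction t with
  | zero => exact ⟨_, isMergingState_zero d c⟩
  | succ t ih =>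
    obtain ⟨R, hR⟩ := ih
    exact hR.exists_succ (hcover _)

end Iteration

/-! ### Private neighborhood trees -/

section Trees

variable {V : Type*} {G : SimpleGraph V}

/-- The subgraph of `G` with vertex set `C` and the adjacencies of a graph `T` on the type `C`, for
turning spanning trees of components into subgraphs of `G`. -/
def subgraphOn (C : Set V) (T : SimpleGraph C) (h : ∀ a b, T.Adj a b → G.Adj a b) :
    G.Subgraph where
  verts := C
  Adj a b := ∃ (ha : a ∈ C) (hb : b ∈ C), T.Adj ⟨a, ha⟩ ⟨b, hb⟩
  adj_sub := fun ⟨_, _, hab⟩ => h _ _ hab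
  edge_vert := fun ⟨ha, _, _⟩ => ha
  symm := ⟨fun _ _ ⟨ha, hb, hab⟩ => ⟨hb, ha, hab.symm⟩⟩

theorem coe_subgraphOn (C : Set V) (T : SimpleGraph C) (h : ∀ a b, T.Adj a b → G.Adj a b) :
    (subgraphOn C T h).coe = T := by
  ext a b
  exact ⟨fun ⟨_, _, hab⟩ => hab, fun hab => ⟨a.2, b.2, hab⟩⟩

theorem exists_isTree_verts_eq_componentSet [Finite V] {E : Set (Sym2 V)} (hE : E ⊆ G.edgeSet)
    (a : V) :
    ∃ T : G.Subgraph, T.coe.IsTree ∧ T.verts = componentSet E a ∧ T.edgeSet ⊆ E := by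
  have hconn : ((SimpleGraph.fromEdgeSet E).induce (componentSet E a)).Connected :=
    SimpleGraph.ConnectedComponent.connected_toSimpleGraph _
  obtain ⟨T, hTle, hT⟩ := hconn.exists_isTree_le
  have hTE (x y : componentSet E a) (hxy : T.Adj x y) : s((x : V), (y : V)) ∈ E :=
    ((SimpleGraph.fromEdgeSet_adj E).1 (hTle hxy)).1
  have hTG (x y : componentSet E a) (hxy : T.Adj x y) : G.Adj x y := hE (hTE x y hxy)
  refine ⟨subgraphOn _ T hTG, ?_, rfl, fun e he => ?_⟩
  · rwa [coe_subgraphOn]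
  · induction e with
    | _ x y =>
      obtain ⟨hx, hy, hxy⟩ := he
      exact hTE _ _ hxy

theorem notMem_componentSet {E : Set (Sym2 V)} {u a : V} (hu : ∀ e ∈ E, u ∉ e) (hua : u ≠ a) :
    u ∉ componentSet E a := by
  intro h
  obtain ⟨p⟩ := SimpleGraph.ConnectedComponent.eq.1 h
  cases p with
  | nil => exact hua rfl
  | cons h _ => exact hu _ ((SimpleGraph.fromEdgeSet_adj E).1 h).1 (Sym2.mem_mk_left _ _)

theorem diam_le_ncard_edgeSet_of_isTree [Finite V] {T : SimpleGraph V} (hT : T.IsTree) :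
    T.diam ≤ T.edgeSet.ncard := by
  classical
  have := Fintype.ofFinite V
  have := hT.connected.nonempty
  obtain ⟨x, y, hxy⟩ := T.exists_dist_eq_diam
  obtain ⟨p, hp, hlen⟩ := hT.connected.exists_path_of_dist x y
  have hlt := hp.length_lt
  have hcard := hT.card_edgeFinset
  rw [← SimpleGraph.coe_edgeFinset, Set.ncard_coe_finset]
  omega

theorem diam_coe_le_ncard_edgeSet [Finite V] {T : G.Subgraph} (hT : T.coe.IsTree) :
    T.coe.diam ≤ T.edgeSet.ncard := by
  refine (diam_le_ncard_edgeSet_of_isTree hT).trans ?_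
  rw [← T.image_coe_edgeSet_coe,
    Set.ncard_image_of_injective _ (Sym2.map.injective Subtype.val_injective)]

theorem IsPrivateNeighborhoodTrees.mono {T : V → G.Subgraph} {d c d' c' : ℝ}
    (h : IsPrivateNeighborhoodTrees G T d c) (hd : d ≤ d') (hc : c ≤ c') :
    IsPrivateNeighborhoodTrees G T d' c' where
  isTree := h.isTree
  neighbors_subset := h.neighbors_subset
  avoids := h.avoids
  dilation u := (h.dilation u).trans hd
  congestion e he := (h.congestion e he).trans hc

theorem exists_privateNeighborhoodTrees_of_edges [Finite V] {nb : V → V}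
    (hnb : ∀ u, G.Adj u (nb u)) {d c : ℕ} {R : V → Finset (Sym2 V)}
    (hR : ∀ u, ∀ e ∈ R u, e ∈ G.edgeSet ∧ u ∉ e)
    (hreach : ∀ u v, G.Adj u v → (SimpleGraph.fromEdgeSet (R u : Set (Sym2 V))).Reachable v (nb u))
    (hd : ∀ u, #(R u) ≤ d) (hc : ∀ e, {u | e ∈ R u}.ncard ≤ c) :
    ∃ T : V → G.Subgraph, IsPrivateNeighborhoodTrees G T d c := by
  choose T hT hverts hedge using fun u =>
    exists_isTree_verts_eq_componentSet (fun e he => (hR u e he).1) (nb u)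
  refine ⟨T, hT, fun u v huv => ?_, fun u => ?_, fun u => ?_, fun e _ => ?_⟩
  · rw [hverts]
    exact SimpleGraph.ConnectedComponent.eq.2 (hreach u v huv)
  · rw [hverts]
    exact notMem_componentSet (fun e he => (hR u e he).2) (hnb u).ne
  · have hcard : (T u).edgeSet.ncard ≤ #(R u) := by
      rw [← Set.ncard_coe_finset]
      exact Set.ncard_le_ncard (hedge u)
    exact_mod_cast (diam_coe_le_ncard_edgeSet (hT u)).trans (hcard.trans (hd u))
  · exact_mod_cast (Set.ncard_le_ncard fun u (hu : e ∈ (T u).edgeSet) => hedge u hu).trans (hc e)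

end Trees

section TwoVertexConnected

variable {V : Type*} {G : SimpleGraph V}

theorem exists_adj_of_reachable_of_ne {u v : V} (h : G.Reachable u v) (hne : u ≠ v) :
    ∃ w, G.Adj u w := by
  obtain ⟨p⟩ := h
  cases p with
  | nil => exact absurd rfl hne
  | cons h _ => exact ⟨_, h⟩

theorem IsTwoVertexConnected.nontrivial (hG : IsTwoVertexConnected G) : Nontrivial V := by
  obtain ⟨u⟩ := hG.1.nonempty
  obtain ⟨w, hw⟩ := (hG.2 u).nonempty
  exact ⟨w, u, hw⟩

theorem IsTwoVertexConnected.exists_adj (hG : IsTwoVertexConnected G) (u : V) :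
    ∃ v, G.Adj u v := by
  obtain ⟨w, hw⟩ := (hG.2 u).nonempty
  exact exists_adj_of_reachable_of_ne (hG.1.preconnected u w) (Ne.symm hw)

theorem IsTwoVertexConnected.one_le_diam [Finite V] (hG : IsTwoVertexConnected G) :
    1 ≤ G.diam := by
  have := hG.nontrivial
  exact Nat.one_le_iff_ne_zero.2 (SimpleGraph.connected_iff_diam_ne_zero.1 hG.1)

variable [Fintype V]

theorem IsTwoVertexConnected.exists_adj_ne (hG : IsTwoVertexConnected G)
    (hcard : 3 ≤ Fintype.card V) {u v : V} (huv : G.Adj u v) : ∃ w, w ≠ v ∧ G.Adj u w := by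
  classical
  obtain ⟨z, -, hz⟩ := exists_mem_notMem_of_card_lt_card
    (s := ({u, v} : Finset V)) (t := univ) (card_le_two.trans_lt hcard)
  rw [mem_insert, mem_singleton, not_or] at hz
  obtain ⟨⟨w, hw⟩, h⟩ := exists_adj_of_reachable_of_ne
    ((hG.2 v).preconnected ⟨u, huv.ne⟩ ⟨z, hz.2⟩) fun h => hz.1 (congrArg Subtype.val h).symm
  exact ⟨w, hw, h⟩

theorem IsTwoVertexConnected.two_le_maxDegree [DecidableRel G.Adj] (hG : IsTwoVertexConnected G)
    (hcard : 3 ≤ Fintype.card V) : 2 ≤ G.maxDegree := by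
  obtain ⟨u⟩ := hG.1.nonempty
  obtain ⟨v, hv⟩ := hG.exists_adj u
  obtain ⟨w, hwv, hw⟩ := hG.exists_adj_ne hcard hv
  refine le_trans ?_ (G.degree_le_maxDegree u)
  exact one_lt_card.2 ⟨w, (G.mem_neighborFinset u w).2 hw, v, (G.mem_neighborFinset u v).2 hv, hwv⟩

end TwoVertexConnected

section Logarithms

theorem natLog_two_le_logb (n : ℕ) : (Nat.log 2 n : ℝ) ≤ Real.logb 2 n :=
  mod_cast Real.natLog_le_logb n 2

theorem logb_two_natCast_nonneg (n : ℕ) : 0 ≤ Real.logb 2 n :=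
  (Nat.cast_nonneg _).trans (natLog_two_le_logb n)

theorem one_le_logb_two_natCast {n : ℕ} (hn : 2 ≤ n) : 1 ≤ Real.logb 2 n :=
  le_trans (mod_cast Nat.log_pos one_lt_two hn) (natLog_two_le_logb n)

theorem natLog_two_pow_four_le (n : ℕ) : (Nat.log 2 (n ^ 4) : ℝ) ≤ 4 * Real.logb 2 n :=
  calc (Nat.log 2 (n ^ 4) : ℝ) ≤ Real.logb 2 (n ^ 4 : ℕ) := natLog_two_le_logb _
    _ = 4 * Real.logb 2 n := by rw [Nat.cast_pow, Real.logb_pow, Nat.cast_ofNat]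

end Logarithms

section Reduction

variable {V : Type*} [Fintype V] {G : SimpleGraph V}

theorem exists_privateNeighborhoodTrees_of_gadgetGraph [DecidableRel G.Adj] {nb : V → V}
    (hnb : ∀ u, G.Adj u (nb u)) {d c : ℕ}
    (hcover : ∀ κ : V → V → Set V, HasCycleCover (gadgetGraph κ hnb) d c) :
    ∃ T : V → G.Subgraph, IsPrivateNeighborhoodTrees G T
      (2 * (G.maxDegree * d) : ℕ) ((Nat.log 2 G.maxDegree + 1) * (c * d) : ℕ) := by
  obtain ⟨R, hR⟩ := exists_isMergingState hnb hcover (Nat.log 2 G.maxDegree + 1)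
  refine exists_privateNeighborhoodTrees_of_edges hnb hR.edge
    (fun u v huv => reachable_of_excess_eq_zero ?_ huv)
    (fun u => (Nat.le_add_right _ _).trans (hR.card_add_le u)) hR.congestion
  by_contra hne
  exact (Nat.lt_pow_succ_log_self one_lt_two G.maxDegree).not_ge <|
    (Nat.le_mul_of_pos_left _ (Nat.pos_of_ne_zero hne)).trans (hR.excess_mul_two_pow_le u)

theorem IsTwoVertexConnected.hasCycleCover_gadgetGraph (hG : IsTwoVertexConnected G)
    (hcard : 3 ≤ Fintype.card V) {d c : ℕ}
    (hcover : ∀ (N : ℕ) (H : SimpleGraph (Fin N)), IsBridgeless H →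
      N ≤ 2 * G.edgeSet.ncard → H.diam ≤ 3 * G.diam + 2 → HasCycleCover H d c)
    {nb : V → V} (hnb : ∀ u, G.Adj u (nb u)) {L : Type*} (κ : V → V → L) :
    HasCycleCover (gadgetGraph κ hnb) d c := by
  have := Fintype.ofFinite (GadgetNode G κ)
  have hbridgeless : IsBridgeless (gadgetGraph κ hnb) :=
    gadgetGraph_isBridgeless hnb hG fun u v huv => hG.exists_adj_ne hcard huv
  let f := (gadgetGraph κ hnb).overFinIso rfl
  refine (hcover _ _ (hbridgeless.of_iso f) ?_ ?_).of_iso f.symm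
  · rw [← Nat.card_eq_fintype_card]
    exact card_gadgetNode_le
  · exact (diam_le_of_surjective hbridgeless.1 f.toHom f.surjective).trans
      (gadgetGraph_diam_le hnb hG.1)

theorem IsTwoVertexConnected.exists_privateNeighborhoodTrees_of_card_le_two
    (hG : IsTwoVertexConnected G) (hcard : Fintype.card V ≤ 2) :
    ∃ T : V → G.Subgraph, IsPrivateNeighborhoodTrees G T 0 0 := by
  classical
  choose nb hnb using hG.exists_adj
  have hreach (u v : V) (huv : G.Adj u v) :
      (SimpleGraph.fromEdgeSet ((∅ : Finset (Sym2 V)) : Set (Sym2 V))).Reachable v (nb u) := by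
    suffices v = nb u by rw [this]
    by_contra hne
    exact absurd (card_le_univ {u, v, nb u})
      (by rw [card_eq_three.2 ⟨u, v, nb u, huv.ne, (hnb u).ne, hne, rfl⟩]; omega)
  exact_mod_cast exists_privateNeighborhoodTrees_of_edges (d := 0) (c := 0) (R := fun _ => ∅) hnb
    (by simp) hreach (by simp) (by simp)

theorem IsTwoVertexConnected.exists_privateNeighborhoodTrees_of_hasCycleCover [DecidableRel G.Adj]
    (hG : IsTwoVertexConnected G) {d c : ℕ}
    (hcover : ∀ (N : ℕ) (H : SimpleGraph (Fin N)), IsBridgeless H →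
      N ≤ 2 * G.edgeSet.ncard → H.diam ≤ 5 * G.diam → HasCycleCover H d c) :
    ∃ T : V → G.Subgraph, IsPrivateNeighborhoodTrees G T
      (2 * (d * G.maxDegree)) (2 * (c * d * Real.logb 2 G.maxDegree)) := by
  have hlog := natLog_two_le_logb G.maxDegree
  rcases Nat.lt_or_ge (Fintype.card V) 3 with hcard | hcard
  · obtain ⟨T, hT⟩ := hG.exists_privateNeighborhoodTrees_of_card_le_two (Nat.le_of_lt_succ hcard)
    have := logb_two_natCast_nonneg G.maxDegree
    exact ⟨T, hT.mono (by positivity) (by positivity)⟩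
  choose nb hnb using hG.exists_adj
  have hD := hG.one_le_diam
  obtain ⟨T, hT⟩ := exists_privateNeighborhoodTrees_of_gadgetGraph hnb <|
    hG.hasCycleCover_gadgetGraph hcard
      (fun N H hH hN hdiam => hcover N H hH hN (by omega)) hnb
  refine ⟨T, hT.mono ?_ ?_⟩
  · push_cast
    rw [mul_comm (d : ℝ)]
  · have hΔ := one_le_logb_two_natCast (hG.two_le_maxDegree hcard)
    calc (((Nat.log 2 G.maxDegree + 1) * (c * d) : ℕ) : ℝ)
        = (Nat.log 2 G.maxDegree + 1) * (c * d) := by push_cast; rfl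
      _ ≤ 2 * Real.logb 2 G.maxDegree * (c * d) := by gcongr; linarith
      _ = 2 * (c * d * Real.logb 2 G.maxDegree) := by ring

end Reduction

section Parameters

variable {V : Type*}

theorem two_mul_ncard_edgeSet_le [Fintype V] (G : SimpleGraph V) :
    2 * G.edgeSet.ncard ≤ Fintype.card V ^ 2 := by
  classical
  rw [← SimpleGraph.coe_edgeFinset, Set.ncard_coe_finset]
  calc 2 * #G.edgeFinset ≤ 2 * (Fintype.card V).choose 2 := by
        gcongr
        exact G.card_edgeFinset_le_card_choose_two
    _ ≤ Fintype.card V * (Fintype.card V - 1) := by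
        rw [Nat.choose_two_right]
        exact Nat.mul_div_le _ 2
    _ ≤ Fintype.card V ^ 2 := by
        rw [sq]
        gcongr
        exact Nat.sub_le _ _

theorem HasCycleCover.mono {G : SimpleGraph V} {d c d' c' : ℕ} (h : HasCycleCover G d c)
    (hd : d ≤ d') (hc : c ≤ c') : HasCycleCover G d' c' := by
  obtain ⟨k, v, p, hp, hlength, hcover⟩ := h
  exact ⟨k, v, p, hp, fun i => (hlength i).trans hd,
    fun e he => ⟨(hcover e he).1, (hcover e he).2.trans hc⟩⟩

theorem IsBridgeless.hasCycleCover_of_le_sq {N n D : ℕ} {H : SimpleGraph (Fin N)}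
    (hH : IsBridgeless H) (hN : N ≤ n ^ 2) (hD : H.diam ≤ D) :
    HasCycleCover H ((2 * Nat.log 2 (n ^ 4) + 3) * (2 * D + 1))
      ((Nat.log 2 (n ^ 4) + 1) * (32 * Nat.log 2 (n ^ 4) + 17)) := by
  have hedges : H.edgeSet.ncard ≤ n ^ 4 :=
    calc H.edgeSet.ncard ≤ 2 * H.edgeSet.ncard := Nat.le_mul_of_pos_left _ two_pos
      _ ≤ N ^ 2 := by simpa using two_mul_ncard_edgeSet_le H
      _ ≤ (n ^ 2) ^ 2 := by gcongr
      _ = n ^ 4 := by ring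
  exact (hH.hasCycleCover (Nat.log_mono_right hedges)).mono (by gcongr) le_rfl

theorem IsTwoVertexConnected.exists_privateNeighborhoodTrees [Fintype V] {G : SimpleGraph V}
    [DecidableRel G.Adj] (hG : IsTwoVertexConnected G) :
    ∃ T : V → G.Subgraph, IsPrivateNeighborhoodTrees G T
      (242 * (G.diam * G.maxDegree * Real.logb 2 (Fintype.card V)))
      (175450 * (G.diam * Real.logb 2 G.maxDegree * Real.logb 2 (Fintype.card V) ^ 3)) := by
  have hcard : 2 ≤ Fintype.card V := Fintype.one_lt_card_iff_nontrivial.2 hG.nontrivial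
  obtain ⟨T, hT⟩ := hG.exists_privateNeighborhoodTrees_of_hasCycleCover fun N H hH hN hdiam =>
    hH.hasCycleCover_of_le_sq (hN.trans (two_mul_ncard_edgeSet_le G)) hdiam
  set n := Fintype.card V
  set L := Real.logb 2 n
  have hL : 1 ≤ L := one_le_logb_two_natCast hcard
  have hD : (1 : ℝ) ≤ G.diam := mod_cast hG.one_le_diam
  have hΔ := logb_two_natCast_nonneg G.maxDegree
  have hqL : (Nat.log 2 (n ^ 4) : ℝ) ≤ 4 * L := natLog_two_pow_four_le n
  push_cast at hT
  set q := (Nat.log 2 (n ^ 4) : ℝ)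
  have : 0 ≤ q := Nat.cast_nonneg _
  have hlength : (2 * q + 3) * (2 * (5 * G.diam) + 1) ≤ 121 * (G.diam * L) :=
    calc _ ≤ 11 * L * (11 * G.diam) := by gcongr <;> linarith
      _ = 121 * (G.diam * L) := by ring
  have hcongestion : (q + 1) * (32 * q + 17) ≤ 725 * L ^ 2 :=
    calc _ ≤ 5 * L * (145 * L) := by gcongr <;> linarith
      _ = 725 * L ^ 2 := by ring
  refine ⟨T, hT.mono ?_ ?_⟩
  · calc _ ≤ 2 * (121 * (G.diam * L) * G.maxDegree) := by gcongr
      _ = 242 * (G.diam * G.maxDegree * L) := by ring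
  · calc _ ≤ 2 * (725 * L ^ 2 * (121 * (G.diam * L)) * Real.logb 2 G.maxDegree) := by gcongr
      _ = 175450 * (G.diam * Real.logb 2 G.maxDegree * L ^ 3) := by ring

end Parameters

end PrivateTrees

theorem theorem2 :
    (∃ K : ℕ, ∀ (V : Type*) [Fintype V] (G : SimpleGraph V) [DecidableRel G.Adj],
      PrivateTrees.IsTwoVertexConnected G →
      ∃ T : V → G.Subgraph, PrivateTrees.IsPrivateNeighborhoodTrees G T
        (K * (G.diam * G.maxDegree * Real.logb 2 (Fintype.card V)))
        (K * (G.diam * Real.logb 2 G.maxDegree * Real.logb 2 (Fintype.card V) ^ 3))) ∧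
    (∃ K : ℕ, ∀ (V : Type*) [Fintype V] (G : SimpleGraph V) [DecidableRel G.Adj],
      PrivateTrees.IsTwoVertexConnected G →
      ∀ d c : ℕ,
      (∀ (N : ℕ) (H : SimpleGraph (Fin N)), PrivateTrees.IsBridgeless H →
        N ≤ K * G.edgeSet.ncard → H.diam ≤ K * G.diam → PrivateTrees.HasCycleCover H d c) →
      ∃ T : V → G.Subgraph, PrivateTrees.IsPrivateNeighborhoodTrees G T
        (K * (d * G.maxDegree))
        (K * (c * d * Real.logb 2 G.maxDegree))) := by
  refine ⟨⟨175450, fun V _ G _ hG => ?_⟩, ⟨5, fun V _ G _ hG d c hcover => ?_⟩⟩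
  · obtain ⟨T, hT⟩ := hG.exists_privateNeighborhoodTrees
    have hL := PrivateTrees.logb_two_natCast_nonneg (Fintype.card V)
    exact ⟨T, hT.mono (by gcongr; norm_num) (by norm_num)⟩
  · obtain ⟨T, hT⟩ := hG.exists_privateNeighborhoodTrees_of_hasCycleCover fun N H hH hN hD =>
      hcover N H hH (hN.trans (by gcongr; norm_num)) hD
    have hΔ := PrivateTrees.logb_two_natCast_nonneg G.maxDegree
    exact ⟨T, hT.mono (by gcongr; norm_num) (by gcongr; norm_num)⟩
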